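/- **Setting.** A linear array consists of $K$ subarrays with $M\ge 1$ elements each, $N=KM$ elements in total. Element $m$ of subarray $k$ has position $\varphi_{k,m}\in\mathbb{R}$. For frequencies $\omega_1=\omega_0$ and $\omega_2=\omega_0+\Delta\omega$ let $A\in\mathbb{C}^{N\times 2}$ be the steering matrix, with entries $A_{n,l}=e^{j\omega_l\varphi_n}$, and let $\Pi_A^\perp=I-A(A^HA)^{-1}A^H$. For $T$ snapshots with source coefficients $s_l(t_i)\in\mathbb{C}$ let $D_i\in\mathbb{C}^{N\times 2}$ have entries $[D_i]_{n,l}=j\varphi_ne^{j\omega_l\varphi_n}s_l(t_i)$, and put $$F=\sum_{i=1}^T\mathrm{Re}\{D_i^H\Pi_A^\perp D_i\},\qquad \mathrm{CRB}_{\rm FC}(\Delta\omega)=\tfrac12\,\mathrm{trace}\Big(\tfrac{\sigma^2}{2}F^{-1}\Big),$$ the average Cramér–Rao bound of $(\omega_1,\omega_2)$ for the fully calibrated array with noise power $\sigma^2>0$, regarded as a function of $\Delta\omega$ for fixed $\omega_0$, positions and coefficients. Let $P_l=\sum_{i}|s_l(t_i)|^2$ and assume $P_1,P_2>0$. **Random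 geometry.** Let $D>0$ and $\Omega=2\pi/D$. The positions are random, and the subarray averages $\bar\varphi_k=\frac1M\sum_m\varphi_{k,m}$ are independent and uniformly distributed on $[0,D]$. There are fixed nominal displacements $\delta_{k,m}$ with $|\delta_{k,m}|\le D$ and a number $\eta\ge 0$ such that almost surely $|\varphi_{k,m}-\bar\varphi_k-\delta_{k,m}|\le\eta D$ for all $k,m$. (Rigid subarrays have $\eta=0$; taking $\delta=0$ and $\eta$ small says that each subarray is nearly a point.) **Proposition.** There are absolute constants $c,C>0$ such that, in every such setting, for all $\Delta\omega\ge\Omega$ with $\eta\,\Delta\omega D\le c$ and all $t\in(0,1]$, the following three statements hold simultaneously with probability at least $1-Ce^{-cKt^2}$ (their failure has outer probability at most $Ce^{-cKt^2}$): $A^HA$ is invertible; $F$ is positive definite; and $\mathrm{CRB}_{\rm FC}$ is differentiable at $\Delta\omega$ with $$\left|\frac{\partial\,\mathrm{CRB}_{\rm FC}(\Delta\omega)}{\partial\Delta\omega}\right|\le C\,\frac{\sigma^2}{ND}\left(\frac1{P_1}+\frac1{P_2}\right)\left(t+\frac{1}{\Delta\omega D}+\eta\,\Delta\omega D\right).$$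 -/

import Mathlib

noncomputable section

namespace ArrayCRB

open Matrix

variable {ι : Type*} [Fintype ι] [DecidableEq ι] {L T K M : ℕ}

/-- The steering matrix: `A n l = exp (j ω_l φ_n)`, for elements at positions `φ` on a line
and sources with spatial angular frequencies `ω`. -/
def steering (φ : ι → ℝ) (ω : Fin L → ℝ) : Matrix ι (Fin L) ℂ :=
  Matrix.of fun n l => Complex.exp (Complex.I * (ω l : ℂ) * (φ n : ℂ))

/-- The matrix whose `l`-th column is `(∂ a(ω_l) / ∂ ω_l) s_l`, where `a(ω_l)` is the `l`-th
column of the steering matrix and `s` holds the source coefficients of one snapshot. -/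
def steeringDeriv (φ : ι → ℝ) (ω : Fin L → ℝ) (s : Fin L → ℂ) : Matrix ι (Fin L) ℂ :=
  Matrix.of fun n l =>
    Complex.I * (φ n : ℂ) * Complex.exp (Complex.I * (ω l : ℂ) * (φ n : ℂ)) * s l

/-- The projection onto the orthogonal complement of the column space of the steering matrix:
`I - A (Aᴴ A)⁻¹ Aᴴ`. -/
def projPerp (φ : ι → ℝ) (ω : Fin L → ℝ) : Matrix ι ι ℂ :=
  1 - steering φ ω * ((steering φ ω)ᴴ * steering φ ω)⁻¹ * (steering φ ω)ᴴ

/-- The matrix `F = ∑_i Re (D_iᴴ Π D_i)` of the fully calibrated array, summed over the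
snapshots `i`; `s i l` is the coefficient of source `l` in snapshot `i`. -/
def fimFC (φ : ι → ℝ) (ω : Fin L → ℝ) (s : Fin T → Fin L → ℂ) : Matrix (Fin L) (Fin L) ℝ :=
  ∑ i, ((steeringDeriv φ ω (s i))ᴴ * projPerp φ ω * steeringDeriv φ ω (s i)).map Complex.re

/-- The Cramér–Rao bound matrix of `ω` for the fully calibrated array, with noise power `σ ^ 2`. -/
def crbFC (σ : ℝ) (φ : ι → ℝ) (ω : Fin L → ℝ) (s : Fin T → Fin L → ℂ) :
    Matrix (Fin L) (Fin L) ℝ :=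
  (σ ^ 2 / 2) • (fimFC φ ω s)⁻¹

/-- The frequencies of two sources with separation `Δω`. -/
def twoFreq (ω₀ Δω : ℝ) : Fin 2 → ℝ := ![ω₀, ω₀ + Δω]

/-- The average Cramér–Rao bound of two sources, as a function of their separation `Δω`. -/
def avgCrbFC (σ : ℝ) (φ : ι → ℝ) (s : Fin T → Fin 2 → ℂ) (ω₀ Δω : ℝ) : ℝ :=
  (crbFC σ φ (twoFreq ω₀ Δω) s 0 0 + crbFC σ φ (twoFreq ω₀ Δω) s 1 1) / 2

/-- The total power `∑_i |s_l(t_i)|²` of source `l` over the snapshots. -/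
def sourcePower (s : Fin T → Fin L → ℂ) (l : Fin L) : ℝ := ∑ i, ‖s i l‖ ^ 2

/-- The average position of the elements of subarray `k`; element `m` of subarray `k` is
indexed by `(k, m)`. -/
def subarrayMean (φ : Fin K × Fin M → ℝ) (k : Fin K) : ℝ := (∑ m, φ (k, m)) / (M : ℝ)

end ArrayCRB

end

/-! ### Uniform linear independence of `1`, `x`, `exp (j y x)`, `x exp (j y x)`. -/

noncomputable section
namespace ArrayCRB
open Complex MeasureTheory
open scoped ComplexConjugate

/-! After division of positions by `D`, the problem depends on `y = Δω D ≥ 2π` and on the empirical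
weighted characteristic functions `mom φ p y`, the averages of `φ ^ p * exp (j y φ)`. The matrix `F`
is the entrywise product of the source cross powers with a Schur complement of the Gram matrix of
the array. Its two diagonal entries differ only in the source power, so the average bound is `σ² /
(4N) * (1/P₁ + 1/P₂)` times a rational function `crbShape` of moments (`avgCrbFC_eq`).

Differentiation in `y` sends `mom φ p` to `j * mom φ (p + 1)`. Hence the derivative of `crbShape` is
at most a constant times the largest `‖mom φ p y‖` with `p ≤ 3`, provided its denominators stay away
from zero (`exists_slowAt_crbShape`). `Coercive` provides this: a lower bound on the Gram form of
`1`, `x`, `exp (j y x)`, `x exp (j y x)` over the positions controls `1 - |f₀|²` and the determinant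
of `F`.

Both coercivity and small moments come from comparison with the mean array. On an interval of unit
length the four functions are uniformly independent (`exists_coercive`), and the mean moments at `y`
are `O(1/y)` (`norm_integral_chi_le`). A Hoeffding bound over the `K` independent subarrays gives
deviations of order `t` (`measureReal_mom_sub_expMom_le`); non-rigidity adds `O(η y)`
(`norm_mom_sub_mom_le`). These are the three terms of the final bound. -/

/-- The character of frequency `y` weighted by the monomial of degree `p`. -/
def chi (p : ℕ) (y x : ℝ) : ℂ := (x : ℂ) ^ p * exp (I * (y : ℂ) * (x : ℂ))

lemma norm_exp_I_mul_mul (y x : ℝ) : ‖exp (I * (y : ℂ) * (x : ℂ))‖ = 1 := by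
  rw [mul_assoc, ← ofReal_mul, mul_comm I, norm_exp_ofReal_mul_I]

lemma norm_chi (p : ℕ) (y x : ℝ) : ‖chi p y x‖ = |x| ^ p := by
  simp [chi, norm_exp_I_mul_mul]

lemma norm_chi_le {p : ℕ} (hp : p ≤ 3) (y : ℝ) {x R : ℝ} (hR : 1 ≤ R) (hx : |x| ≤ R) :
    ‖chi p y x‖ ≤ R ^ 3 := by
  rw [norm_chi]
  exact (pow_le_pow_left₀ (abs_nonneg x) hx p).trans (pow_le_pow_right₀ hR hp)

lemma conj_exp_I_mul_mul (y x : ℝ) :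
    conj (exp (I * (y : ℂ) * (x : ℂ))) = exp (I * ((-y : ℝ) : ℂ) * (x : ℂ)) := by
  rw [← exp_conj]; simp

lemma conj_chi (p : ℕ) (y x : ℝ) : conj (chi p y x) = chi p (-y) x := by
  simp only [chi, map_mul, map_pow, conj_ofReal, conj_exp_I_mul_mul]

lemma chi_mul_chi (p p' : ℕ) (y y' x : ℝ) :
    chi p y x * chi p' y' x = chi (p + p') (y + y') x := by
  simp only [chi, ofReal_add, mul_add, add_mul, Complex.exp_add]
  ring

lemma chi_mul_conj_chi (p p' : ℕ) (y y' x : ℝ) :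
    chi p y x * conj (chi p' y' x) = chi (p + p') (y - y') x := by
  rw [conj_chi, chi_mul_chi, sub_eq_add_neg]

lemma continuous_chi_shift (p : ℕ) (y δ : ℝ) : Continuous fun x : ℝ => chi p y (x + δ) := by
  unfold chi; fun_prop

lemma hasDerivAt_chi_freq (p : ℕ) (y x : ℝ) :
    HasDerivAt (fun y => chi p y x) (I * chi (p + 1) y x) y := by
  have h : HasDerivAt (fun y : ℝ => I * (y : ℂ) * (x : ℂ)) (I * 1 * x) y :=
    ((hasDerivAt_id y).ofReal_comp.const_mul I).mul_const _
  have := (h.cexp).const_mul ((x : ℂ) ^ p)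
  refine this.congr_deriv ?_
  simp only [chi]; ring

lemma hasDerivAt_chi_pos (p : ℕ) (y x : ℝ) :
    HasDerivAt (fun x => chi p y x) (p * chi (p - 1) y x + I * y * chi p y x) x := by
  have h : HasDerivAt (fun x : ℝ => I * (y : ℂ) * (x : ℂ)) (I * y * 1) x :=
    (hasDerivAt_id x).ofReal_comp.const_mul (I * (y : ℂ))
  have h2 : HasDerivAt (fun x : ℝ => (x : ℂ) ^ p) (p * (x : ℂ) ^ (p - 1) * 1) x :=
    (hasDerivAt_id x).ofReal_comp.pow p
  refine (h2.mul h.cexp).congr_deriv ?_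
  simp only [chi]; ring

lemma norm_chi_sub_chi_le {p : ℕ} (hp : p ≤ 3) (y : ℝ) {x x' : ℝ} (hx : |x| ≤ 3) (hx' : |x'| ≤ 3) :
    ‖chi p y x - chi p y x'‖ ≤ 81 * (1 + |y|) * |x - x'| := by
  have hb : ∀ z ∈ Set.Icc (-3 : ℝ) 3,
      ‖(p * chi (p - 1) y z + I * y * chi p y z : ℂ)‖ ≤ 81 * (1 + |y|) := by
    intro z hz
    have hz' : |z| ≤ 3 := abs_le.mpr hz
    have h1 := norm_chi_le (p := p - 1) (by omega) y (by norm_num) hz'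
    have h2 := norm_chi_le hp y (by norm_num) hz'
    have hp' : (p : ℝ) ≤ 3 := by exact_mod_cast hp
    calc _ ≤ ‖(p * chi (p - 1) y z : ℂ)‖ + ‖(I * y * chi p y z : ℂ)‖ := norm_add_le _ _
      _ = p * ‖chi (p - 1) y z‖ + |y| * ‖chi p y z‖ := by simp
      _ ≤ 3 * 3 ^ 3 + |y| * 3 ^ 3 := by gcongr
      _ ≤ _ := by nlinarith [abs_nonneg y]
  exact Convex.norm_image_sub_le_of_norm_hasDerivWithin_le
    (fun z _ => (hasDerivAt_chi_pos p y z).hasDerivWithinAt) hb (convex_Icc _ _)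
    (abs_le.mp hx') (abs_le.mp hx)

/-- Integration by parts: the boundary terms and the integral of the lower-degree term are bounded,
which leaves a factor `1 / |y|`. Since `|x + δ| ≤ 2`, the constant is `8 + 8 + 3 * 8 = 40`. -/
lemma norm_integral_chi_le {p : ℕ} (hp : p ≤ 3) {y δ : ℝ} (hy : y ≠ 0) (hδ : |δ| ≤ 1) :
    ‖∫ x in (0 : ℝ)..1, chi p y (x + δ)‖ ≤ 40 / |y| := by
  have hi : ∀ q : ℕ, IntervalIntegrable (fun x => chi q y (x + δ)) volume 0 1 := fun q =>
    (continuous_chi_shift q y δ).intervalIntegrable _ _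
  have hF : (∫ x in (0 : ℝ)..1, ((p : ℂ) * chi (p - 1) y (x + δ) + I * y * chi p y (x + δ)))
      = chi p y (1 + δ) - chi p y (0 + δ) := by
    refine intervalIntegral.integral_eq_sub_of_hasDerivAt
      (f := fun x => chi p y (x + δ)) (fun x _ => ?_)
      (((hi _).const_mul _).add ((hi _).const_mul _))
    exact (hasDerivAt_chi_pos p y (x + δ)).comp_add_const x δ
  rw [intervalIntegral.integral_add ((hi _).const_mul _) ((hi _).const_mul _),
    intervalIntegral.integral_const_mul, intervalIntegral.integral_const_mul] at hF
  have hd := abs_le.mp hδ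
  have hb : ∀ q ≤ 3, ∀ x ∈ Set.Icc (0 : ℝ) 1, ‖chi q y (x + δ)‖ ≤ 2 ^ 3 := fun q hq x hx =>
    norm_chi_le hq y (by norm_num) (abs_le.mpr ⟨by linarith [hx.1], by linarith [hx.2]⟩)
  have h1 : ‖∫ x in (0 : ℝ)..1, chi (p - 1) y (x + δ)‖ ≤ 2 ^ 3 * |(1 : ℝ) - 0| := by
    refine intervalIntegral.norm_integral_le_of_norm_le_const fun x hx => ?_
    rw [Set.uIoc_of_le zero_le_one] at hx
    exact hb _ (by omega) x ⟨hx.1.le, hx.2⟩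
  have hp' : (p : ℝ) ≤ 3 := by exact_mod_cast hp
  have hy' : 0 < |y| := abs_pos.mpr hy
  rw [le_div_iff₀ hy']
  calc ‖∫ x in (0 : ℝ)..1, chi p y (x + δ)‖ * |y|
      = ‖(I * y : ℂ) * ∫ x in (0 : ℝ)..1, chi p y (x + δ)‖ := by simp [mul_comm]
    _ = ‖chi p y (1 + δ) - chi p y (0 + δ) - p * ∫ x in (0 : ℝ)..1, chi (p - 1) y (x + δ)‖ := by
        rw [← hF]; congr 1; ring
    _ ≤ ‖chi p y (1 + δ)‖ + ‖chi p y (0 + δ)‖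
        + ‖(p : ℂ) * ∫ x in (0 : ℝ)..1, chi (p - 1) y (x + δ)‖ :=
        (norm_sub_le _ _).trans (by gcongr; exact norm_sub_le _ _)
    _ ≤ 2 ^ 3 + 2 ^ 3 + 3 * (2 ^ 3 * |(1 : ℝ) - 0|) := by
        rw [norm_mul, Complex.norm_natCast]
        have := hb p hp 1 ⟨zero_le_one, le_rfl⟩
        have := hb p hp 0 ⟨le_rfl, zero_le_one⟩
        gcongr
    _ ≤ 40 := by norm_num

/-- The linear combination of `1`, `x`, `exp (j y x)` and `x exp (j y x)` with coefficients `w`;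
the index `(a, b)` stands for `x ^ a * exp (j b y x)`. -/
def comb (w : Fin 2 × Fin 2 → ℂ) (y x : ℝ) : ℂ := ∑ i, w i * chi i.1 ((i.2 : ℕ) * y) x

/-- The Hermitian form of the Gram matrix whose entries are the weighted characteristic
function `G`. -/
def gramForm (G : ℕ → ℝ → ℂ) (y : ℝ) (w : Fin 2 × Fin 2 → ℂ) : ℂ :=
  ∑ i, ∑ j, w i * conj (w j) * G (i.1 + j.1) ((i.2 : ℕ) * y - (j.2 : ℕ) * y)

lemma norm_sq_comb (w : Fin 2 × Fin 2 → ℂ) (y x : ℝ) :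
    ((‖comb w y x‖ ^ 2 : ℝ) : ℂ) = gramForm (fun p z => chi p z x) y w := by
  rw [ofReal_pow, ← mul_conj', comb, gramForm, map_sum, Finset.sum_mul_sum]
  refine Finset.sum_congr rfl fun i _ => Finset.sum_congr rfl fun j _ => ?_
  rw [map_mul, ← chi_mul_conj_chi]; ring

/-- Cauchy–Schwarz over the four indices: entrywise closeness of two Gram matrices transfers
coercivity from one to the other. -/
lemma norm_gramForm_sub_le {G G' : ℕ → ℝ → ℂ} {y r : ℝ} (w : Fin 2 × Fin 2 → ℂ)
    (h : ∀ p ≤ 3, ∀ b b' : Fin 2, ‖G p ((b : ℕ) * y - (b' : ℕ) * y)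
      - G' p ((b : ℕ) * y - (b' : ℕ) * y)‖ ≤ r) :
    ‖gramForm G y w - gramForm G' y w‖ ≤ 4 * r * ∑ i, ‖w i‖ ^ 2 := by
  have hr : 0 ≤ r := (norm_nonneg _).trans (h 0 (by norm_num) 0 0)
  calc ‖gramForm G y w - gramForm G' y w‖
      ≤ ∑ i, ∑ j, ‖w i‖ * ‖w j‖ * r := by
        rw [gramForm, gramForm, ← Finset.sum_sub_distrib]
        refine norm_sum_le_of_le _ fun i _ => ?_
        rw [← Finset.sum_sub_distrib]
        refine norm_sum_le_of_le _ fun j _ => ?_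
        rw [← mul_sub, norm_mul, norm_mul, RCLike.norm_conj]
        gcongr
        exact h _ (by omega) _ _
    _ = (∑ i, ‖w i‖) ^ 2 * r := by
        rw [sq, Finset.sum_mul_sum, Finset.sum_mul]
        simp_rw [Finset.sum_mul]
    _ ≤ (4 * ∑ i, ‖w i‖ ^ 2) * r := by
        gcongr
        simpa using sq_sum_le_card_mul_sum_sq (s := Finset.univ) (f := fun i => ‖w i‖)
    _ = _ := by ring

lemma gramForm_sum {κ : Type*} (s : Finset κ) (G : κ → ℕ → ℝ → ℂ) (c y : ℝ)
    (w : Fin 2 × Fin 2 → ℂ) :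
    gramForm (fun p z => (∑ k ∈ s, G k p z) / c) y w = (∑ k ∈ s, gramForm (G k) y w) / c := by
  simp only [gramForm, Finset.sum_div, Finset.mul_sum]
  rw [Finset.sum_comm (s := s)]
  refine Finset.sum_congr rfl fun i _ => ?_
  rw [Finset.sum_comm (s := s)]
  exact Finset.sum_congr rfl fun j _ => Finset.sum_congr rfl fun k _ => (mul_div_assoc _ _ _).symm

lemma continuous_comb : Continuous fun z : (Fin 2 × Fin 2 → ℂ) × ℝ × ℝ => comb z.1 z.2.1 z.2.2 := by
  unfold comb chi; fun_prop

lemma integral_norm_sq_comb (w : Fin 2 × Fin 2 → ℂ) (y δ : ℝ) :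
    ((∫ x in (0 : ℝ)..1, ‖comb w y (x + δ)‖ ^ 2 : ℝ) : ℂ)
      = gramForm (fun p z => ∫ x in (0 : ℝ)..1, chi p z (x + δ)) y w := by
  have hc : ∀ (q : ℕ) (y : ℝ), Continuous fun x => chi q y (x + δ) := fun q y =>
    continuous_chi_shift q y δ
  rw [← intervalIntegral.integral_ofReal]
  simp_rw [norm_sq_comb, gramForm]
  rw [intervalIntegral.integral_finsetSum
    (fun i _ => Continuous.intervalIntegrable
      (continuous_finsetSum _ fun j _ => (hc _ _).const_mul _) _ _)]
  refine Finset.sum_congr rfl fun i _ => ?_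
  rw [intervalIntegral.integral_finsetSum (fun j _ => ((hc _ _).const_mul _).intervalIntegrable _ _)]
  simp_rw [intervalIntegral.integral_const_mul]

lemma comb_eq (w : Fin 2 × Fin 2 → ℂ) (y x : ℝ) :
    comb w y x = (w (0, 0) + w (1, 0) * x) + (w (0, 1) + w (1, 1) * x) * exp (I * y * x) := by
  simp [comb, chi, Fintype.sum_prod_type]
  ring

lemma exists_comb_ne_zero {w : Fin 2 × Fin 2 → ℂ} (hw : w ≠ 0) {y : ℝ} (hy : 2 * Real.pi ≤ y)
    (δ : ℝ) : ∃ x ∈ Set.Icc (0 : ℝ) 1, comb w y (x + δ) ≠ 0 := by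
  by_contra! h
  have hπ := Real.pi_pos
  have hy0 : 0 < y := by linarith
  have hyc : (y : ℂ) ≠ 0 := by exact_mod_cast hy0.ne'
  set E := exp (I * y * δ) with hE
  have hE0 : E ≠ 0 := exp_ne_zero _
  -- Sampling at fractions `r` of a period, which fits into the interval because `y ≥ 2π`. At `r =
  -- 0, 1/4, 1/2, 1` the exponential is `1, I, -1, 1` up to the factor `E`, and the four equations
  -- force all coefficients to vanish.
  have key : ∀ r ∈ Set.Icc (0 : ℝ) 1, (w (0, 0) + w (1, 0) * (r * (2 * Real.pi / y) + δ))
      + (w (0, 1) + w (1, 1) * (r * (2 * Real.pi / y) + δ)) * (exp (2 * Real.pi * I * r) * E)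
        = 0 := by
    intro r hr
    have := h (r * (2 * Real.pi / y)) ⟨by have := hr.1; positivity,
      mul_le_one₀ hr.2 (by positivity) ((div_le_one hy0).mpr hy)⟩
    rw [comb_eq] at this
    rw [hE, ← Complex.exp_add, ← this]
    push_cast
    congr 3
    field_simp
  have k0 := key 0 (by norm_num)
  have k1 := key 1 (by norm_num)
  have k2 := key (1 / 2) (by norm_num)
  have k4 := key (1 / 4) (by norm_num)
  have e2 : exp (2 * Real.pi * I * (1 / 2 : ℝ)) = -1 := by
    rw [← exp_pi_mul_I]; congr 1; push_cast; ring
  have e4 : exp (2 * Real.pi * I * (1 / 4 : ℝ)) = I := by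
    rw [show (2 * Real.pi * I * (1 / 4 : ℝ) : ℂ) = Real.pi / 2 * I by push_cast; ring,
      exp_pi_div_two_mul_I]
  rw [e2] at k2
  rw [e4] at k4
  simp only [ofReal_zero, mul_zero, exp_zero, ofReal_one, mul_one, exp_two_pi_mul_I] at k0 k1
  push_cast at k2 k4
  have hτ : (2 * Real.pi / y : ℂ) ≠ 0 := by
    have : (Real.pi : ℂ) ≠ 0 := by exact_mod_cast hπ.ne'
    exact div_ne_zero (mul_ne_zero two_ne_zero this) hyc
  generalize (2 * Real.pi / y : ℂ) = τ at *
  have hb : w (1, 0) = -(w (1, 1) * E) := by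
    apply mul_right_cancel₀ hτ
    linear_combination k1 - k0
  have h2 : w (0, 1) + w (1, 1) * (1 / 2 * τ + δ) = 0 := by
    apply mul_right_cancel₀ hE0
    rw [hb] at k0 k2
    linear_combination (k0 - k2) / 2
  have hI : (I - 1 : ℂ) ≠ 0 := by
    intro h0
    simpa using congrArg Complex.re h0
  have h4 : w (0, 1) + w (1, 1) * (1 / 4 * τ + δ) = 0 := by
    apply mul_right_cancel₀ (mul_ne_zero hE0 hI)
    rw [hb] at k0 k4
    linear_combination k4 - k0
  have hd : w (1, 1) = 0 := by
    apply mul_right_cancel₀ hτ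
    linear_combination 4 * h2 - 4 * h4
  rw [hd] at h4 hb
  have hb' : w (1, 0) = 0 := by simpa using hb
  have hc' : w (0, 1) = 0 := by simpa using h4
  rw [hb', hd, hc'] at k0
  apply hw
  ext ⟨i, j⟩
  fin_cases i <;> fin_cases j <;> simp_all

lemma comb_smul (r : ℝ) (w : Fin 2 × Fin 2 → ℂ) (y x : ℝ) :
    comb (fun i => (r : ℂ) * w i) y x = r * comb w y x := by
  simp [comb, Finset.mul_sum, mul_assoc]

/-- Compactness: the integral is continuous and positive on the product of the ranges of `y` and `δ`
with the unit sphere, so it attains a positive minimum there. Homogeneity in `w` extends the bound.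
-/
lemma exists_coercive_on_bounded (Y : ℝ) :
    ∃ r > 0, ∀ y ∈ Set.Icc (2 * Real.pi) Y, ∀ δ ∈ Set.Icc (-1 : ℝ) 1, ∀ w : Fin 2 × Fin 2 → ℂ,
      r * ∑ i, ‖w i‖ ^ 2 ≤ ∫ x in (0 : ℝ)..1, ‖comb w y (x + δ)‖ ^ 2 := by
  rcases lt_or_ge Y (2 * Real.pi) with hY | hY
  · exact ⟨1, one_pos, fun y hy => absurd (hy.1.trans hy.2) (not_le.mpr hY)⟩
  have hcont : Continuous fun z : ℝ × ℝ × (Fin 2 × Fin 2 → ℂ) =>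
      ∫ x in (0 : ℝ)..1, ‖comb z.2.2 z.1 (x + z.2.1)‖ ^ 2 := by
    refine intervalIntegral.continuous_parametric_intervalIntegral_of_continuous' ?_ _ _
    exact (continuous_comb.comp (by fun_prop : Continuous
      fun z : (ℝ × ℝ × (Fin 2 × Fin 2 → ℂ)) × ℝ => (z.1.2.2, z.1.1, z.2 + z.1.2.1))).norm.pow 2
  obtain ⟨z, hz, hmin⟩ := (((isCompact_Icc (a := 2 * Real.pi) (b := Y)).prod
    ((isCompact_Icc (a := (-1 : ℝ)) (b := 1)).prod
      (isCompact_sphere (0 : Fin 2 × Fin 2 → ℂ) 1))).exists_isMinOn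
      ((Set.nonempty_Icc.mpr hY).prod ((Set.nonempty_Icc.mpr (by norm_num)).prod
        (NormedSpace.sphere_nonempty.mpr zero_le_one))) hcont.continuousOn)
  have hpos : 0 < ∫ x in (0 : ℝ)..1, ‖comb z.2.2 z.1 (x + z.2.1)‖ ^ 2 := by
    have hw : z.2.2 ≠ 0 := by
      intro h0
      have := hz.2.2
      simp [h0] at this
    obtain ⟨x, hx, hne⟩ := exists_comb_ne_zero hw hz.1.1 z.2.1
    refine intervalIntegral.integral_pos zero_lt_one (Continuous.continuousOn ?_)
      (fun _ _ => by positivity) ⟨x, hx, by positivity⟩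
    exact (continuous_comb.comp (by fun_prop : Continuous
      fun x : ℝ => (z.2.2, z.1, x + z.2.1))).norm.pow 2
  set r := ∫ x in (0 : ℝ)..1, ‖comb z.2.2 z.1 (x + z.2.1)‖ ^ 2
  refine ⟨r / 4, by positivity, fun y hy δ hδ w => ?_⟩
  have hsum : ∑ i, ‖w i‖ ^ 2 ≤ 4 * ‖w‖ ^ 2 := by
    calc ∑ i, ‖w i‖ ^ 2 ≤ ∑ _i : Fin 2 × Fin 2, ‖w‖ ^ 2 :=
          Finset.sum_le_sum fun i _ => by gcongr; exact norm_le_pi_norm w i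
      _ = _ := by simp
  refine (mul_le_mul_of_nonneg_left hsum (by positivity)).trans ?_
  rcases eq_or_ne w 0 with rfl | hw
  · simp [comb]
  have hn : 0 < ‖w‖ := norm_pos_iff.mpr hw
  have h1 : r ≤ ∫ x in (0 : ℝ)..1, ‖comb (fun i => ((‖w‖⁻¹ : ℝ) : ℂ) * w i) y (x + δ)‖ ^ 2 := by
    refine isMinOn_iff.mp hmin (y, δ, fun i => ((‖w‖⁻¹ : ℝ) : ℂ) * w i) ⟨hy, hδ, ?_⟩
    have : (fun i => ((‖w‖⁻¹ : ℝ) : ℂ) * w i) = ((‖w‖⁻¹ : ℝ) : ℂ) • w := rfl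
    rw [mem_sphere_zero_iff_norm, this, norm_smul]
    simp [hn.ne']
  simp_rw [comb_smul, norm_mul, mul_pow] at h1
  rw [intervalIntegral.integral_const_mul] at h1
  simp only [norm_real, norm_inv, norm_norm, inv_pow] at h1
  rw [inv_mul_eq_div, le_div_iff₀ (by positivity)] at h1
  linarith

/-- The functions `1`, `x`, `exp (j y x)`, `x exp (j y x)` are uniformly linearly independent in
`L²` of an interval of unit length, as long as the interval holds a full period. -/
theorem exists_coercive :
    ∃ r > 0, ∀ y, 2 * Real.pi ≤ y → ∀ δ, |δ| ≤ 1 → ∀ w : Fin 2 × Fin 2 → ℂ,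
      r * ∑ i, ‖w i‖ ^ 2 ≤ ∫ x in (0 : ℝ)..1, ‖comb w y (x + δ)‖ ^ 2 := by
  -- The single value `y = 2π` suffices for combinations with one frequency, as their modulus does
  -- not depend on `y`.
  obtain ⟨r₁, hr₁, h₁⟩ := exists_coercive_on_bounded (2 * Real.pi)
  -- Beyond `320 / r₁` the interaction of the two frequencies costs at most `4 * (40 / y) ≤ r₁ / 2`.
  obtain ⟨r₂, hr₂, h₂⟩ := exists_coercive_on_bounded (320 / r₁)
  refine ⟨min r₂ (r₁ / 2), by positivity, fun y hy δ hδ w => ?_⟩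
  have hS : 0 ≤ ∑ i, ‖w i‖ ^ 2 := by positivity
  have hπ := Real.pi_pos
  have hy0 : 0 < y := by linarith
  rcases le_or_gt y (320 / r₁) with hY | hY
  · exact (mul_le_mul_of_nonneg_right (min_le_left _ _) hS).trans
      (h₂ y ⟨hy, hY⟩ δ (abs_le.mp hδ) w)
  refine (mul_le_mul_of_nonneg_right (min_le_right _ _) hS).trans ?_
  set G : ℕ → ℝ → ℂ := fun p z => ∫ x in (0 : ℝ)..1, chi p z (x + δ) with hG
  -- The Gram matrix with the terms between different frequencies removed; its form splits into the
  -- parts `wp` and `wq` of `w`.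
  set G' : ℕ → ℝ → ℂ := fun p z => if z = 0 then G p z else 0 with hG'
  set Q := fun (y : ℝ) (w : Fin 2 × Fin 2 → ℂ) => ∫ x in (0 : ℝ)..1, ‖comb w y (x + δ)‖ ^ 2 with hQ
  have hclose : ‖gramForm G y w - gramForm G' y w‖ ≤ 4 * (40 / y) * ∑ i, ‖w i‖ ^ 2 := by
    refine norm_gramForm_sub_le w fun p hp b b' => ?_
    by_cases hz : (b : ℕ) * y - (b' : ℕ) * y = 0
    · simp only [hG', hz, if_true, sub_self, norm_zero]; positivity
    · simp only [hG', hz, if_false, sub_zero]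
      refine (norm_integral_chi_le hp hz hδ).trans ?_
      have : |(b : ℕ) * y - (b' : ℕ) * y| = y := by
        fin_cases b <;> fin_cases b' <;> simp_all [abs_of_pos]
      rw [this]
  set wp : Fin 2 × Fin 2 → ℂ := fun i => if i.2 = 0 then w i else 0 with hwp
  set wq : Fin 2 × Fin 2 → ℂ := fun i => if i.2 = 1 then w i else 0 with hwq
  have hsplit : gramForm G' y w = ((Q (2 * Real.pi) wp + Q (2 * Real.pi) wq : ℝ) : ℂ) := by
    rw [hQ]
    push_cast
    rw [integral_norm_sq_comb, integral_norm_sq_comb]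
    simp [gramForm, Fintype.sum_prod_type, hwp, hwq, hG', hy0.ne', hG]
    ring
  have hp := h₁ (2 * Real.pi) ⟨le_rfl, le_rfl⟩ δ (abs_le.mp hδ) wp
  have hq := h₁ (2 * Real.pi) ⟨le_rfl, le_rfl⟩ δ (abs_le.mp hδ) wq
  have hs : ∑ i, ‖w i‖ ^ 2 = ∑ i, ‖wp i‖ ^ 2 + ∑ i, ‖wq i‖ ^ 2 := by
    simp [Fintype.sum_prod_type, hwp, hwq]
    ring
  have hQy : gramForm G y w = ((Q y w : ℝ) : ℂ) := (integral_norm_sq_comb w y δ).symm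
  rw [hQy, hsplit, ← ofReal_sub, norm_real, Real.norm_eq_abs] at hclose
  have h3 := (abs_le.mp hclose).1
  have h4 : 4 * (40 / y) * ∑ i, ‖w i‖ ^ 2 ≤ r₁ / 2 * ∑ i, ‖w i‖ ^ 2 := by
    refine mul_le_mul_of_nonneg_right ?_ hS
    rw [div_lt_iff₀ hr₁] at hY
    rw [← mul_div_assoc, div_le_iff₀ hy0]
    linarith
  change r₁ / 2 * _ ≤ Q y w
  change _ ≤ Q (2 * Real.pi) wp at hp
  change _ ≤ Q (2 * Real.pi) wq at hq
  rw [hs] at h3 h4 ⊢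
  linarith

end ArrayCRB
end

/-! ### Simultaneous bounds on a function and its derivative through rational expressions. -/

noncomputable section
namespace ArrayCRB
open Complex MeasureTheory
open scoped ComplexConjugate

/-- `f` is bounded by `B` at `x` and has a derivative there that is bounded by `B * ε`. -/
def SlowAt {E : Type*} [NormedAddCommGroup E] [NormedSpace ℝ E] (f : ℝ → E) (x B ε : ℝ) : Prop :=
  ‖f x‖ ≤ B ∧ ∃ d, HasDerivAt f d x ∧ ‖d‖ ≤ B * ε

namespace SlowAt

section
variable {E : Type*} [NormedAddCommGroup E] [NormedSpace ℝ E] {f g : ℝ → E} {x B B' ε : ℝ}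

lemma const (hε : 0 ≤ ε) {a : E} (ha : ‖a‖ ≤ B) : SlowAt (fun _ => a) x B ε :=
  ⟨ha, 0, hasDerivAt_const x a, by
    rw [norm_zero]; exact mul_nonneg ((norm_nonneg a).trans ha) hε⟩

lemma add (hf : SlowAt f x B ε) (hg : SlowAt g x B' ε) :
    SlowAt (fun y => f y + g y) x (B + B') ε := by
  obtain ⟨hf0, d, hd, hdb⟩ := hf
  obtain ⟨hg0, e, he, heb⟩ := hg
  refine ⟨(norm_add_le _ _).trans (add_le_add hf0 hg0), d + e, hd.fun_add he, ?_⟩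
  linarith [norm_add_le d e]

lemma sub (hf : SlowAt f x B ε) (hg : SlowAt g x B' ε) :
    SlowAt (fun y => f y - g y) x (B + B') ε := by
  obtain ⟨hf0, d, hd, hdb⟩ := hf
  obtain ⟨hg0, e, he, heb⟩ := hg
  refine ⟨(norm_sub_le _ _).trans (add_le_add hf0 hg0), d - e, hd.fun_sub he, ?_⟩
  linarith [norm_sub_le d e]

end

lemma mul {R : Type*} [NormedRing R] [NormedAlgebra ℝ R] {f g : ℝ → R} {x B B' ε : ℝ}
    (hf : SlowAt f x B ε) (hg : SlowAt g x B' ε) :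
    SlowAt (fun y => f y * g y) x (2 * (B * B')) ε := by
  obtain ⟨hf0, d, hd, hdb⟩ := hf
  obtain ⟨hg0, e, he, heb⟩ := hg
  have hB : 0 ≤ B := (norm_nonneg _).trans hf0
  have hB' : 0 ≤ B' := (norm_nonneg _).trans hg0
  refine ⟨?_, _, hd.fun_mul he, ?_⟩
  · have := (norm_mul_le (f x) (g x)).trans (mul_le_mul hf0 hg0 (norm_nonneg _) hB)
    linarith [mul_nonneg hB hB']
  · calc ‖d * g x + f x * e‖ ≤ ‖d * g x‖ + ‖f x * e‖ := norm_add_le _ _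
      _ ≤ ‖d‖ * ‖g x‖ + ‖f x‖ * ‖e‖ := add_le_add (norm_mul_le _ _) (norm_mul_le _ _)
      _ ≤ (B * ε) * B' + B * (B' * ε) := by
        have := (norm_nonneg d).trans hdb
        gcongr
      _ = _ := by ring

/-- The summand `r⁻¹` bounds the value and `B / r ^ 2` the derivative. -/
lemma inv {R : Type*} [NontriviallyNormedField R] [NormedAlgebra ℝ R] {f : ℝ → R} {x B ε r : ℝ}
    (hε : 0 ≤ ε) (hr : 0 < r) (hf : SlowAt f x B ε) (h : r ≤ ‖f x‖) :
    SlowAt (fun y => (f y)⁻¹) x (r⁻¹ + B / r ^ 2) ε := by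
  obtain ⟨hf0, d, hd, hdb⟩ := hf
  have hB : 0 ≤ B := (norm_nonneg _).trans hf0
  have hne : f x ≠ 0 := norm_pos_iff.mp (hr.trans_le h)
  refine ⟨?_, _, hd.fun_inv hne, ?_⟩
  · rw [norm_inv]
    have : ‖f x‖⁻¹ ≤ r⁻¹ := inv_anti₀ hr h
    have : 0 ≤ B / r ^ 2 := by positivity
    linarith
  · rw [norm_div, norm_neg, norm_pow]
    calc ‖d‖ / ‖f x‖ ^ 2 ≤ (B * ε) / r ^ 2 := by
          have := (norm_nonneg d).trans hdb
          gcongr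
      _ = B / r ^ 2 * ε := by ring
      _ ≤ _ := by
        have : 0 ≤ r⁻¹ * ε := by positivity
        linarith

lemma re {f : ℝ → ℂ} {x B ε : ℝ} (hf : SlowAt f x B ε) : SlowAt (fun y => (f y).re) x B ε := by
  obtain ⟨hf0, d, hd, hdb⟩ := hf
  exact ⟨(abs_re_le_norm _).trans hf0, d.re,
    reCLM.hasFDerivAt.comp_hasDerivAt x hd, (abs_re_le_norm _).trans hdb⟩

lemma conjugate {f : ℝ → ℂ} {x B ε : ℝ} (hf : SlowAt f x B ε) :
    SlowAt (fun y => conj (f y)) x B ε := by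
  obtain ⟨hf0, d, hd, hdb⟩ := hf
  exact ⟨by rwa [RCLike.norm_conj], star d, hd.star, by rwa [norm_star]⟩

end SlowAt

/-- The diagonal entry of the Schur complement of the normalised Gram matrix of the array, in terms
of its weighted characteristic functions `f₀`, `f₁` and its moments `m₁`, `m₂`. -/
def schurDiag (m₁ m₂ f₀ f₁ : ℂ) : ℂ :=
  m₂ - (m₁ * m₁ + f₁ * conj f₁ - m₁ * (f₀ * conj f₁ + conj f₀ * f₁)) * (1 - f₀ * conj f₀)⁻¹

/-- The off-diagonal entry of the Schur complement of the normalised Gram matrix of the array. -/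
def schurOff (m₁ f₀ f₁ f₂ : ℂ) : ℂ :=
  f₂ - (2 * m₁ * f₁ - m₁ * m₁ * f₀ - conj f₀ * (f₁ * f₁)) * (1 - f₀ * conj f₀)⁻¹

/-- The average Cramér–Rao bound as a function of the Schur complement, up to a factor. -/
def crbShape (q m₁ m₂ f₀ f₁ f₂ : ℂ) : ℝ :=
  (schurDiag m₁ m₂ f₀ f₁).re * ((schurDiag m₁ m₂ f₀ f₁).re * (schurDiag m₁ m₂ f₀ f₁).re
    - (q * schurOff m₁ f₀ f₁ f₂).re * (q * schurOff m₁ f₀ f₁ f₂).re)⁻¹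

/-- `crbShape` is built by finitely many ring operations and two inversions, each of which preserves
`SlowAt`. The value `27 = 3 ^ 3` bounds moments of degree at most three when positions are at most
`3` in modulus. -/
lemma exists_slowAt_crbShape {r : ℝ} (hr : 0 < r) :
    ∃ B, ∀ (f₀ f₁ f₂ : ℝ → ℂ) (q m₁ m₂ : ℂ) (x ε : ℝ), 0 ≤ ε →
      SlowAt f₀ x 27 ε → SlowAt f₁ x 27 ε → SlowAt f₂ x 27 ε → ‖m₁‖ ≤ 27 → ‖m₂‖ ≤ 27 → ‖q‖ ≤ 1 →
      r ≤ ‖1 - f₀ x * conj (f₀ x)‖ →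
      r ^ 2 ≤ (schurDiag m₁ m₂ (f₀ x) (f₁ x)).re * (schurDiag m₁ m₂ (f₀ x) (f₁ x)).re
        - (q * schurOff m₁ (f₀ x) (f₁ x) (f₂ x)).re * (q * schurOff m₁ (f₀ x) (f₁ x) (f₂ x)).re →
      SlowAt (fun y => crbShape q m₁ m₂ (f₀ y) (f₁ y) (f₂ y)) x B ε := by
  -- The constant is left open and determined by unification with the composed bounds at the end.
  apply Exists.intro
  intro f₀ f₁ f₂ q m₁ m₂ x ε hε h₀ h₁ h₂ hm₁ hm₂ hq hden hdet
  have c₁ := SlowAt.const (x := x) hε hm₁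
  have c₂ := SlowAt.const (x := x) hε hm₂
  have cq := SlowAt.const (x := x) hε hq
  have two : SlowAt (fun _ => (2 : ℂ)) x 2 ε := SlowAt.const hε (by simp)
  have one : SlowAt (fun _ => (1 : ℂ)) x 1 ε := SlowAt.const hε (by simp)
  have hinv := (one.sub (h₀.mul h₀.conjugate)).inv hε hr hden
  have hd : SlowAt (fun y => (schurDiag m₁ m₂ (f₀ y) (f₁ y)).re) x _ ε :=
    (c₂.sub ((((c₁.mul c₁).add (h₁.mul h₁.conjugate)).sub
      (c₁.mul ((h₀.mul h₁.conjugate).add (h₀.conjugate.mul h₁)))).mul hinv)).re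
  have ho : SlowAt (fun y => (q * schurOff m₁ (f₀ y) (f₁ y) (f₂ y)).re) x _ ε :=
    (cq.mul (h₂.sub (((((two.mul c₁).mul h₁).sub ((c₁.mul c₁).mul h₀)).sub
      (h₀.conjugate.mul (h₁.mul h₁))).mul hinv))).re
  exact hd.mul (((hd.mul hd).sub (ho.mul ho)).inv hε (pow_pos hr 2)
    (hdet.trans (le_abs_self _)))

end ArrayCRB
end

/-! ### Gram matrices, moments and the structure of `F`. -/

noncomputable section
namespace ArrayCRB
open Complex MeasureTheory Matrix
open scoped ComplexConjugate

section Projection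
variable {m n : Type*} [Fintype m] [Fintype n]

lemma star_dotProduct_self_eq (v : m → ℂ) : star v ⬝ᵥ v = ((∑ i, ‖v i‖ ^ 2 : ℝ) : ℂ) := by
  simp only [dotProduct, Pi.star_apply, RCLike.star_def, conj_mul', ofReal_sum, ofReal_pow]

/-- The residual of `b` is orthogonal to the columns of `A`. Writing it as `b + A v` makes it a
combination to which coercivity applies. -/
lemma star_dotProduct_projection_mulVec [DecidableEq m] [DecidableEq n] {A : Matrix m n ℂ}
    (hA : (Aᴴ * A).det ≠ 0) (b : m → ℂ) :
    star b ⬝ᵥ ((1 - A * (Aᴴ * A)⁻¹ * Aᴴ) *ᵥ b)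
      = ((∑ i, ‖(b + A *ᵥ (-((Aᴴ * A)⁻¹ *ᵥ (Aᴴ *ᵥ b)))) i‖ ^ 2 : ℝ) : ℂ) := by
  set v := (Aᴴ * A)⁻¹ *ᵥ (Aᴴ *ᵥ b) with hv
  have hP : (1 - A * (Aᴴ * A)⁻¹ * Aᴴ) *ᵥ b = b - A *ᵥ v := by
    rw [sub_mulVec, one_mulVec, hv]
    simp only [mulVec_mulVec, Matrix.mul_assoc]
  have hz : Aᴴ *ᵥ (b - A *ᵥ v) = 0 := by
    rw [mulVec_sub, hv, mulVec_mulVec, mulVec_mulVec,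
      Matrix.mul_nonsing_inv _ (isUnit_iff_ne_zero.mpr hA), one_mulVec, sub_self]
  rw [← star_dotProduct_self_eq, mulVec_neg, ← sub_eq_add_neg, hP, star_sub, sub_dotProduct,
    star_mulVec, ← dotProduct_mulVec, hz, dotProduct_zero, sub_zero]

end Projection

/-- The form minus its diagonal lower bound is nonnegative, so `b² ≤ (a - p) (c - q)`; then `a c -
b² ≥ p q + q (a - p) + p (c - q)`. -/
lemma mul_sub_sq_ge_of_quadratic_ge {a b c p q : ℝ} (hp : 0 ≤ p) (hq : 0 ≤ q)
    (h : ∀ x y : ℝ, p * x ^ 2 + q * y ^ 2 ≤ a * x ^ 2 + 2 * b * x * y + c * y ^ 2) :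
    p * q ≤ a * c - b * b := by
  have ha : p ≤ a := by simpa using h 1 0
  have hc : q ≤ c := by simpa using h 0 1
  have hd : discrim (a - p) (2 * b) (c - q) ≤ 0 :=
    discrim_le_zero fun x => by nlinarith [h x 1]
  rw [discrim] at hd
  nlinarith [mul_nonneg hp (sub_nonneg.mpr hc), mul_nonneg hq (sub_nonneg.mpr ha)]

variable {ι : Type*} [Fintype ι] {T : ℕ}

/-- The weighted empirical characteristic function of the element positions. -/
def mom (φ : ι → ℝ) (p : ℕ) (y : ℝ) : ℂ := (∑ n, chi p y (φ n)) / (Fintype.card ι : ℝ)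

lemma conj_mom (φ : ι → ℝ) (p : ℕ) (y : ℝ) : conj (mom φ p y) = mom φ p (-y) := by
  simp [mom, conj_chi]

lemma mom_zero_zero [Nonempty ι] (φ : ι → ℝ) : mom φ 0 0 = 1 := by
  simp [mom, chi]

lemma hasDerivAt_mom (φ : ι → ℝ) (p : ℕ) (y : ℝ) :
    HasDerivAt (mom φ p) (I * mom φ (p + 1) y) y := by
  have := (HasDerivAt.fun_sum (u := Finset.univ)
    fun n _ => hasDerivAt_chi_freq p y (φ n)).div_const ((Fintype.card ι : ℝ) : ℂ)
  refine this.congr_deriv ?_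
  rw [mom, ← Finset.mul_sum, mul_div_assoc]

lemma norm_mom_le {φ : ι → ℝ} (hφ : ∀ n, |φ n| ≤ 3) {p : ℕ} (hp : p ≤ 3) (y : ℝ) :
    ‖mom φ p y‖ ≤ 27 := by
  rw [mom, norm_div, norm_real, Real.norm_of_nonneg (Nat.cast_nonneg _)]
  refine div_le_of_le_mul₀ (Nat.cast_nonneg _) (by norm_num) ?_
  calc ‖∑ n, chi p y (φ n)‖ ≤ ∑ _n : ι, (27 : ℝ) :=
        norm_sum_le_of_le _ fun n _ => (norm_chi_le hp y (by norm_num) (hφ n)).trans (by norm_num)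
    _ = _ := by simp [mul_comm]

lemma slowAt_mom {φ : ι → ℝ} (hφ : ∀ n, |φ n| ≤ 3) {p : ℕ} (hp : p ≤ 2) {y ε : ℝ}
    (h : ‖mom φ (p + 1) y‖ ≤ ε) : SlowAt (mom φ p) y 27 ε :=
  ⟨norm_mom_le hφ (by omega) y, _, hasDerivAt_mom φ p y, by
    rw [norm_mul, norm_I, one_mul]
    linarith [(norm_nonneg _).trans h]⟩

/-- The mean square of `comb w y` over the element positions. -/
def meanSq (φ : ι → ℝ) (y : ℝ) (w : Fin 2 × Fin 2 → ℂ) : ℝ :=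
  (∑ n, ‖comb w y (φ n)‖ ^ 2) / (Fintype.card ι : ℝ)

lemma gramForm_mom (φ : ι → ℝ) (y : ℝ) (w : Fin 2 × Fin 2 → ℂ) :
    gramForm (mom φ) y w = (meanSq φ y w : ℂ) := by
  have := gramForm_sum Finset.univ (fun n p z => chi p z (φ n)) (Fintype.card ι : ℝ) y w
  rw [meanSq, ofReal_div, ofReal_sum]
  simp_rw [norm_sq_comb]
  exact this

/-- Uniform linear independence of `1`, `x`, `exp (j y x)`, `x exp (j y x)` over the element
positions. -/
def Coercive (φ : ι → ℝ) (y r : ℝ) : Prop :=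
  ∀ w : Fin 2 × Fin 2 → ℂ, r * ∑ i, ‖w i‖ ^ 2 ≤ meanSq φ y w

/-- The test function is `exp (j y x) - f₀` with `f₀ = mom φ 0 y`: its mean square is `1 - |f₀|²`,
and one of its coefficients is `1`. -/
lemma Coercive.le_norm_one_sub [Nonempty ι] {φ : ι → ℝ} {y r : ℝ} (hr : 0 < r)
    (h : Coercive φ y r) : r ≤ ‖1 - mom φ 0 y * conj (mom φ 0 y)‖ := by
  set w : Fin 2 × Fin 2 → ℂ := fun i =>
    if i.1 = 0 then (if i.2 = 0 then -mom φ 0 y else 1) else 0 with hw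
  have h1 : gramForm (mom φ) y w = 1 - mom φ 0 y * conj (mom φ 0 y) := by
    simp [gramForm, Fintype.sum_prod_type, hw, mom_zero_zero, conj_mom]
    ring
  have h2 := h w
  rw [← h1, gramForm_mom, norm_real, Real.norm_eq_abs]
  refine le_trans ?_ (h2.trans (le_abs_self _))
  have : (1 : ℝ) ≤ ∑ i, ‖w i‖ ^ 2 := by
    simp [Fintype.sum_prod_type, hw]
  nlinarith

/-- The steering matrix with its rows scaled by the element positions. -/
def weightedSteering {ι : Type*} (φ : ι → ℝ) {L : ℕ} (ω : Fin L → ℝ) : Matrix ι (Fin L) ℂ :=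
  Matrix.of fun n l => (φ n : ℂ) * steering φ ω n l

/-- The matrix of the sums of `φ ^ p` over the array against all pairs of sources. -/
def gramMat (φ : ι → ℝ) {L : ℕ} (ω : Fin L → ℝ) (p : ℕ) : Matrix (Fin L) (Fin L) ℂ :=
  Matrix.of fun l l' => ∑ n, chi p (ω l' - ω l) (φ n)

section
variable {L : ℕ} (φ : ι → ℝ) (ω : Fin L → ℝ)

lemma steering_eq_chi {ι : Type*} (φ : ι → ℝ) (n : ι) (l : Fin L) :
    steering φ ω n l = chi 0 (ω l) (φ n) := by
  simp [steering, chi]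

lemma weightedSteering_eq_chi {ι : Type*} (φ : ι → ℝ) (n : ι) (l : Fin L) :
    weightedSteering φ ω n l = chi 1 (ω l) (φ n) := by
  simp [weightedSteering, steering, chi]

lemma sum_star_chi_mul_chi (p p' : ℕ) (l l' : Fin L) :
    ∑ n, star (chi p (ω l) (φ n)) * chi p' (ω l') (φ n) = gramMat φ ω (p + p') l l' := by
  refine Finset.sum_congr rfl fun n _ => ?_
  rw [mul_comm, RCLike.star_def, chi_mul_conj_chi, add_comm]

lemma steering_gram : (steering φ ω)ᴴ * steering φ ω = gramMat φ ω 0 := by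
  ext l l'
  simp only [mul_apply, conjTranspose_apply, steering_eq_chi, sum_star_chi_mul_chi]

lemma steering_weighted : (steering φ ω)ᴴ * weightedSteering φ ω = gramMat φ ω 1 := by
  ext l l'
  simp only [mul_apply, conjTranspose_apply, steering_eq_chi, weightedSteering_eq_chi,
    sum_star_chi_mul_chi, zero_add]

lemma weighted_steering : (weightedSteering φ ω)ᴴ * steering φ ω = gramMat φ ω 1 := by
  ext l l'
  simp only [mul_apply, conjTranspose_apply, steering_eq_chi, weightedSteering_eq_chi,
    sum_star_chi_mul_chi, add_zero]

lemma weighted_weighted : (weightedSteering φ ω)ᴴ * weightedSteering φ ω = gramMat φ ω 2 := by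
  ext l l'
  simp only [mul_apply, conjTranspose_apply, weightedSteering_eq_chi, sum_star_chi_mul_chi]

lemma steeringDeriv_eq {ι : Type*} (φ : ι → ℝ) (s : Fin L → ℂ) :
    steeringDeriv φ ω s = weightedSteering φ ω * diagonal fun l => I * s l := by
  ext n l
  simp [steeringDeriv, weightedSteering, steering]
  ring

variable [DecidableEq ι]

lemma weighted_proj_weighted : (weightedSteering φ ω)ᴴ * projPerp φ ω * weightedSteering φ ω
    = gramMat φ ω 2 - gramMat φ ω 1 * (gramMat φ ω 0)⁻¹ * gramMat φ ω 1 := by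
  rw [projPerp, Matrix.mul_sub, Matrix.sub_mul, Matrix.mul_one, weighted_weighted, ← steering_gram]
  nth_rewrite 1 [← weighted_steering]
  rw [← steering_weighted]
  simp only [Matrix.mul_assoc]

/-- The cross power of two sources. -/
def crossPower (s : Fin T → Fin L → ℂ) (l l' : Fin L) : ℂ := ∑ i, conj (s i l) * s i l'

/-- A snapshot enters only through diagonal factors on both sides of a fixed matrix, so the sum over
snapshots becomes an entrywise factor. -/
lemma fimFC_apply (s : Fin T → Fin L → ℂ) (l l' : Fin L) :
    fimFC φ ω s l l' = (crossPower s l l' *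
      (gramMat φ ω 2 - gramMat φ ω 1 * (gramMat φ ω 0)⁻¹ * gramMat φ ω 1) l l').re := by
  have : ∀ i, (steeringDeriv φ ω (s i))ᴴ * projPerp φ ω * steeringDeriv φ ω (s i)
      = diagonal (fun l => star (I * s i l)) *
        (gramMat φ ω 2 - gramMat φ ω 1 * (gramMat φ ω 0)⁻¹ * gramMat φ ω 1) *
        diagonal fun l => I * s i l := by
    intro i
    rw [steeringDeriv_eq, conjTranspose_mul, diagonal_conjTranspose, ← weighted_proj_weighted]
    simp only [Matrix.mul_assoc]
    rfl
  rw [fimFC, Matrix.sum_apply, crossPower, Finset.sum_mul, re_sum]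
  refine Finset.sum_congr rfl fun i _ => ?_
  rw [map_apply, this, mul_diagonal, diagonal_mul]
  congr 1
  simp only [RCLike.star_def, map_mul, conj_I]
  linear_combination (-(conj (s i l) * s i l' *
      (gramMat φ ω 2 - gramMat φ ω 1 * (gramMat φ ω 0)⁻¹ * gramMat φ ω 1) l l')) * I_mul_I

lemma crossPower_self (s : Fin T → Fin L → ℂ) (l : Fin L) :
    crossPower s l l = (sourcePower s l : ℂ) := by
  simp [crossPower, sourcePower, conj_mul']

lemma conj_crossPower (s : Fin T → Fin L → ℂ) (l l' : Fin L) :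
    conj (crossPower s l l') = crossPower s l' l := by
  simp [crossPower, mul_comm]

lemma norm_crossPower_le (s : Fin T → Fin L → ℂ) (l l' : Fin L) :
    ‖crossPower s l l'‖ ≤ √(sourcePower s l * sourcePower s l') := by
  refine Real.le_sqrt_of_sq_le ?_
  calc ‖crossPower s l l'‖ ^ 2 ≤ (∑ i, ‖s i l‖ * ‖s i l'‖) ^ 2 := by
        gcongr
        exact norm_sum_le_of_le _ fun i _ => by simp
    _ ≤ _ := Finset.sum_mul_sq_le_sq_mul_sq _ _ _

end

end ArrayCRB
end

/-! ### Two sources: coercivity, the Fisher matrix and the derivative of the bound. -/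

noncomputable section
namespace ArrayCRB
open Complex MeasureTheory Matrix
open scoped ComplexConjugate

variable {ι : Type*} [Fintype ι] {T : ℕ}

/-- The base frequency contributes only the unimodular factor `exp (j ω₀ φ)`, so it plays no role in
the estimates. -/
lemma norm_steering_mulVec_add {ι : Type*} (φ : ι → ℝ) (ω₀ y : ℝ) (u v : Fin 2 → ℂ) (n : ι) :
    ‖(weightedSteering φ (twoFreq ω₀ y) *ᵥ u + steering φ (twoFreq ω₀ y) *ᵥ v) n‖
      = ‖comb (fun i => ![v, u] i.1 i.2) y (φ n)‖ := by
  have : (weightedSteering φ (twoFreq ω₀ y) *ᵥ u + steering φ (twoFreq ω₀ y) *ᵥ v) n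
      = exp (I * ω₀ * φ n) * comb (fun i => ![v, u] i.1 i.2) y (φ n) := by
    rw [comb_eq]
    simp [mulVec, dotProduct, weightedSteering, steering, twoFreq, mul_add, add_mul,
      Complex.exp_add]
    ring
  rw [this, norm_mul, norm_exp_I_mul_mul, one_mul]

variable [Nonempty ι] {φ : ι → ℝ} {y r : ℝ}

lemma Coercive.sum_norm_sq_ge (h : Coercive φ y r) (ω₀ : ℝ) (u v : Fin 2 → ℂ) :
    Fintype.card ι * r * (∑ l, ‖u l‖ ^ 2 + ∑ l, ‖v l‖ ^ 2) ≤
      ∑ n, ‖(weightedSteering φ (twoFreq ω₀ y) *ᵥ u + steering φ (twoFreq ω₀ y) *ᵥ v) n‖ ^ 2 := by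
  have hN : (0 : ℝ) < Fintype.card ι := by exact_mod_cast Fintype.card_pos
  have h1 := h fun i => ![v, u] i.1 i.2
  rw [meanSq, le_div_iff₀ hN] at h1
  simp_rw [norm_steering_mulVec_add]
  refine le_trans (le_of_eq ?_) h1
  simp [Fintype.sum_prod_type]
  ring

lemma Coercive.det_ne_zero (hr : 0 < r) (h : Coercive φ y r) (ω₀ : ℝ) :
    ((steering φ (twoFreq ω₀ y))ᴴ * steering φ (twoFreq ω₀ y)).det ≠ 0 := by
  have hN : (0 : ℝ) < Fintype.card ι := by exact_mod_cast Fintype.card_pos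
  rw [Ne, ← exists_mulVec_eq_zero_iff]
  rintro ⟨v, hv, h0⟩
  apply hv
  have h1 := h.sum_norm_sq_ge ω₀ 0 v
  have h2 : star (steering φ (twoFreq ω₀ y) *ᵥ v) ⬝ᵥ (steering φ (twoFreq ω₀ y) *ᵥ v) = 0 := by
    rw [star_mulVec, ← dotProduct_mulVec, mulVec_mulVec, h0, dotProduct_zero]
  rw [star_dotProduct_self_eq, ofReal_eq_zero] at h2
  simp only [mulVec_zero, zero_add, h2, Pi.zero_apply, norm_zero] at h1
  have h3 : ∑ l, ‖v l‖ ^ 2 ≤ 0 := by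
    have : (0 : ℝ) < Fintype.card ι * r := by positivity
    simp only [ne_eq, OfNat.ofNat_ne_zero, not_false_eq_true, zero_pow, Finset.sum_const_zero,
      zero_add] at h1
    exact nonpos_of_mul_nonpos_right h1 this
  have h4 := (Finset.sum_eq_zero_iff_of_nonneg (fun l _ => by positivity)).mp
    (le_antisymm h3 (by positivity))
  ext l
  simpa using h4 l (Finset.mem_univ l)

lemma gramMat_twoFreq (φ : ι → ℝ) (ω₀ y : ℝ) (p : ℕ) :
    gramMat φ (twoFreq ω₀ y) p = ((Fintype.card ι : ℝ) : ℂ) •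
      !![mom φ p 0, mom φ p y; conj (mom φ p y), mom φ p 0] := by
  have hN : (Fintype.card ι : ℂ) ≠ 0 := by exact_mod_cast Fintype.card_ne_zero
  ext l l'
  fin_cases l <;> fin_cases l' <;> simp [gramMat, twoFreq, conj_mom] <;>
    simp only [mom, ofReal_natCast] <;>
    field_simp

lemma gramMat_schur (φ : ι → ℝ) (ω₀ y : ℝ) :
    gramMat φ (twoFreq ω₀ y) 2 - gramMat φ (twoFreq ω₀ y) 1 * (gramMat φ (twoFreq ω₀ y) 0)⁻¹ *
        gramMat φ (twoFreq ω₀ y) 1 = ((Fintype.card ι : ℝ) : ℂ) •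
      !![schurDiag (mom φ 1 0) (mom φ 2 0) (mom φ 0 y) (mom φ 1 y),
        schurOff (mom φ 1 0) (mom φ 0 y) (mom φ 1 y) (mom φ 2 y);
        conj (schurOff (mom φ 1 0) (mom φ 0 y) (mom φ 1 y) (mom φ 2 y)),
        schurDiag (mom φ 1 0) (mom φ 2 0) (mom φ 0 y) (mom φ 1 y)] := by
  have hN : ((Fintype.card ι : ℝ) : ℂ) ≠ 0 := by exact_mod_cast Fintype.card_ne_zero
  have hm : conj (mom φ 1 0) = mom φ 1 0 := by rw [conj_mom, neg_zero]
  simp only [gramMat_twoFreq, mom_zero_zero, schurDiag, schurOff, map_sub, map_mul, map_inv₀,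
    map_ofNat, map_one, conj_conj, hm]
  generalize ((Fintype.card ι : ℝ) : ℂ) = N at *
  -- Conjugates become free variables, which turns the claim into a purely algebraic identity.
  generalize conj (mom φ 0 y) = g₀
  generalize conj (mom φ 1 y) = g₁
  generalize conj (mom φ 2 y) = g₂
  generalize mom φ 0 y = f₀
  generalize mom φ 1 y = f₁
  generalize mom φ 2 y = f₂
  generalize mom φ 1 0 = m₁
  generalize mom φ 2 0 = m₂
  have hinv : (N • !![1, f₀; g₀, 1])⁻¹ = (N⁻¹ * (1 - f₀ * g₀)⁻¹) • !![1, -f₀; -g₀, 1] := by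
    rw [Matrix.inv_def, adjugate_fin_two, Ring.inverse_eq_inv', det_fin_two]
    have : (N • !![1, f₀; g₀, 1]) 0 0 * (N • !![1, f₀; g₀, 1]) 1 1
      - (N • !![1, f₀; g₀, 1]) 0 1 * (N • !![1, f₀; g₀, 1]) 1 0 = N * (N * (1 - f₀ * g₀)) := by
      simp; ring
    rw [this, mul_inv, mul_inv]
    -- The inverse is opaque here, so the formula also covers a singular Gram matrix, where both
    -- sides are zero.
    generalize (1 - f₀ * g₀)⁻¹ = d
    ext l l'
    fin_cases l <;> fin_cases l' <;> simp <;> field_simp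
  rw [hinv, mul_comm g₀ f₀]
  generalize (1 - f₀ * g₀)⁻¹ = d
  ext l l'
  fin_cases l <;> fin_cases l' <;> simp <;> field_simp <;> ring

variable [DecidableEq ι]

lemma Coercive.fimFC_quadratic_ge (hr : 0 < r) (h : Coercive φ y r) (ω₀ : ℝ)
    (s : Fin T → Fin 2 → ℂ) (x : Fin 2 → ℝ) :
    Fintype.card ι * r * ∑ l, sourcePower s l * x l ^ 2
      ≤ x ⬝ᵥ (fimFC φ (twoFreq ω₀ y) s *ᵥ x) := by
  set A := steering φ (twoFreq ω₀ y) with hA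
  set W := weightedSteering φ (twoFreq ω₀ y) with hW
  have hre : ∀ M : Matrix (Fin 2) (Fin 2) ℂ, x ⬝ᵥ (M.map re *ᵥ x)
      = (star (fun l => (x l : ℂ)) ⬝ᵥ (M *ᵥ fun l => (x l : ℂ))).re := by
    intro M
    simp [dotProduct, mulVec, Fin.sum_univ_two]
  have hterm : ∀ i, Fintype.card ι * r * ∑ l, ‖s i l‖ ^ 2 * x l ^ 2 ≤
      x ⬝ᵥ (((steeringDeriv φ (twoFreq ω₀ y) (s i))ᴴ * projPerp φ (twoFreq ω₀ y) *
        steeringDeriv φ (twoFreq ω₀ y) (s i)).map re *ᵥ x) := by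
    intro i
    set u : Fin 2 → ℂ := fun l => I * s i l * x l with hu
    have hD : steeringDeriv φ (twoFreq ω₀ y) (s i) *ᵥ (fun l => (x l : ℂ)) = W *ᵥ u := by
      rw [steeringDeriv_eq, ← mulVec_mulVec]
      congr 1
      ext l
      simp [hu, mulVec_diagonal]
    rw [hre, ← mulVec_mulVec, ← mulVec_mulVec, dotProduct_mulVec, ← star_mulVec, hD, projPerp,
      star_dotProduct_projection_mulVec (h.det_ne_zero hr ω₀), ofReal_re]
    -- The coefficients of the projection correction only enlarge the lower bound and are dropped.
    refine le_trans ?_ (h.sum_norm_sq_ge ω₀ u _)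
    have : ∑ l, ‖s i l‖ ^ 2 * x l ^ 2 = ∑ l, ‖u l‖ ^ 2 := by
      simp [hu, mul_pow]
    rw [this]
    gcongr
    exact le_add_of_nonneg_right (by positivity)
  calc Fintype.card ι * r * ∑ l, sourcePower s l * x l ^ 2
      = ∑ i, Fintype.card ι * r * ∑ l, ‖s i l‖ ^ 2 * x l ^ 2 := by
        rw [← Finset.mul_sum, Finset.sum_comm]
        simp_rw [sourcePower, Finset.sum_mul]
    _ ≤ _ := Finset.sum_le_sum fun i _ => hterm i
    _ = _ := by rw [fimFC, sum_mulVec, dotProduct_sum]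

section
variable (s : Fin T → Fin 2 → ℂ) (ω₀ : ℝ)

lemma fimFC_diag (φ : ι → ℝ) (y : ℝ) (l : Fin 2) :
    fimFC φ (twoFreq ω₀ y) s l l = Fintype.card ι * sourcePower s l *
      (schurDiag (mom φ 1 0) (mom φ 2 0) (mom φ 0 y) (mom φ 1 y)).re := by
  rw [fimFC_apply, gramMat_schur, crossPower_self, re_ofReal_mul]
  fin_cases l <;> simp <;> ring

lemma fimFC_zero_one (φ : ι → ℝ) (y : ℝ) :
    fimFC φ (twoFreq ω₀ y) s 0 1 = Fintype.card ι *
      (crossPower s 0 1 * schurOff (mom φ 1 0) (mom φ 0 y) (mom φ 1 y) (mom φ 2 y)).re := by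
  rw [fimFC_apply, gramMat_schur]
  simp
  ring

lemma fimFC_one_zero (φ : ι → ℝ) (y : ℝ) :
    fimFC φ (twoFreq ω₀ y) s 1 0 = fimFC φ (twoFreq ω₀ y) s 0 1 := by
  rw [fimFC_apply, fimFC_apply, gramMat_schur, ← conj_crossPower s 0 1]
  simp

/-- The normalised cross power of the two sources. -/
def coherence (s : Fin T → Fin 2 → ℂ) : ℂ :=
  crossPower s 0 1 / (√(sourcePower s 0 * sourcePower s 1) : ℝ)

lemma norm_coherence_le : ‖coherence s‖ ≤ 1 := by
  rw [coherence, norm_div, norm_real, Real.norm_of_nonneg (Real.sqrt_nonneg _)]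
  exact div_le_one_of_le₀ (norm_crossPower_le s 0 1) (Real.sqrt_nonneg _)

variable {s}

lemma re_crossPower_mul (h₀ : 0 < sourcePower s 0) (h₁ : 0 < sourcePower s 1) (z : ℂ) :
    (crossPower s 0 1 * z).re = √(sourcePower s 0 * sourcePower s 1) * (coherence s * z).re := by
  have : ((√(sourcePower s 0 * sourcePower s 1) : ℝ) : ℂ) ≠ 0 := by
    exact_mod_cast (Real.sqrt_pos.mpr (mul_pos h₀ h₁)).ne'
  rw [← re_ofReal_mul, coherence]
  congr 1
  field_simp

lemma fimFC_det (h₀ : 0 < sourcePower s 0) (h₁ : 0 < sourcePower s 1) (φ : ι → ℝ) (y : ℝ) :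
    fimFC φ (twoFreq ω₀ y) s 0 0 * fimFC φ (twoFreq ω₀ y) s 1 1
        - fimFC φ (twoFreq ω₀ y) s 0 1 * fimFC φ (twoFreq ω₀ y) s 0 1 =
      (Fintype.card ι : ℝ) ^ 2 * (sourcePower s 0 * sourcePower s 1) *
        ((schurDiag (mom φ 1 0) (mom φ 2 0) (mom φ 0 y) (mom φ 1 y)).re *
          (schurDiag (mom φ 1 0) (mom φ 2 0) (mom φ 0 y) (mom φ 1 y)).re -
        (coherence s * schurOff (mom φ 1 0) (mom φ 0 y) (mom φ 1 y) (mom φ 2 y)).re *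
          (coherence s * schurOff (mom φ 1 0) (mom φ 0 y) (mom φ 1 y) (mom φ 2 y)).re) := by
  rw [fimFC_diag, fimFC_diag, fimFC_zero_one, re_crossPower_mul h₀ h₁]
  have := Real.mul_self_sqrt (mul_pos h₀ h₁).le
  linear_combination (-(Fintype.card ι : ℝ) ^ 2 *
    (coherence s * schurOff (mom φ 1 0) (mom φ 0 y) (mom φ 1 y) (mom φ 2 y)).re ^ 2) * this

/-- The diagonal entries of `F` share the factor `schurDiag`, so the trace of the inverse is
proportional to `(P₁ + P₂) / (P₁ P₂)`. The identity holds at every `y`, with zero inverses at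
singular points, and can therefore be differentiated. -/
lemma avgCrbFC_eq (σ : ℝ) (h₀ : 0 < sourcePower s 0) (h₁ : 0 < sourcePower s 1) (φ : ι → ℝ)
    (y : ℝ) :
    avgCrbFC σ φ s ω₀ y = σ ^ 2 / (4 * Fintype.card ι) * (1 / sourcePower s 0 + 1 / sourcePower s 1)
      * crbShape (coherence s) (mom φ 1 0) (mom φ 2 0) (mom φ 0 y) (mom φ 1 y) (mom φ 2 y) := by
  have hN : (Fintype.card ι : ℝ) ≠ 0 := by exact_mod_cast Fintype.card_ne_zero
  have hdet := fimFC_det ω₀ h₀ h₁ φ y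
  rw [crbShape, avgCrbFC, crbFC, Matrix.inv_def, Ring.inverse_eq_inv', det_fin_two,
    fimFC_one_zero, hdet, adjugate_fin_two]
  simp only [Matrix.smul_apply, smul_eq_mul, of_apply, cons_val', cons_val_zero, cons_val_one,
    cons_val_fin_one, fimFC_diag, mul_inv]
  generalize ((_ : ℝ) - _)⁻¹ = d
  field_simp
  ring

lemma Coercive.fimFC_posDef (hr : 0 < r) (h : Coercive φ y r)
    (hs : ∀ l, 0 < sourcePower s l) : (fimFC φ (twoFreq ω₀ y) s).PosDef := by
  have hN : (0 : ℝ) < Fintype.card ι := by exact_mod_cast Fintype.card_pos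
  rw [posDef_iff_dotProduct_mulVec]
  refine ⟨?_, fun x hx => ?_⟩
  · ext i j
    have := fimFC_one_zero s ω₀ φ y
    fin_cases i <;> fin_cases j <;> simp [conjTranspose_apply, this]
  · rw [star_trivial]
    refine lt_of_lt_of_le ?_ (h.fimFC_quadratic_ge hr ω₀ s x)
    refine mul_pos (by positivity) ?_
    obtain ⟨l, hl⟩ := Function.ne_iff.mp hx
    refine Finset.sum_pos' (fun l _ => mul_nonneg (hs l).le (sq_nonneg _))
      ⟨l, Finset.mem_univ l, mul_pos (hs l) ?_⟩
    exact sq_pos_of_ne_zero hl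

/-- Dividing the determinant of `F` by `N² P₁ P₂` removes the array size and the powers. The base
frequency does not occur, so it is taken to be `0`. -/
lemma Coercive.schur_det_ge (hr : 0 < r) (h : Coercive φ y r) (hs : ∀ l, 0 < sourcePower s l) :
    r ^ 2 ≤ (schurDiag (mom φ 1 0) (mom φ 2 0) (mom φ 0 y) (mom φ 1 y)).re *
          (schurDiag (mom φ 1 0) (mom φ 2 0) (mom φ 0 y) (mom φ 1 y)).re -
        (coherence s * schurOff (mom φ 1 0) (mom φ 0 y) (mom φ 1 y) (mom φ 2 y)).re *
          (coherence s * schurOff (mom φ 1 0) (mom φ 0 y) (mom φ 1 y) (mom φ 2 y)).re := by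
  have hN : (0 : ℝ) < Fintype.card ι := by exact_mod_cast Fintype.card_pos
  have h0 := hs 0
  have h1 := hs 1
  have hq := mul_sub_sq_ge_of_quadratic_ge
    (a := fimFC φ (twoFreq 0 y) s 0 0) (b := fimFC φ (twoFreq 0 y) s 0 1)
    (c := fimFC φ (twoFreq 0 y) s 1 1)
    (p := Fintype.card ι * r * sourcePower s 0) (q := Fintype.card ι * r * sourcePower s 1)
    (by positivity) (by positivity) (fun a b => by
      have := h.fimFC_quadratic_ge hr 0 s ![a, b]
      simp only [Fin.sum_univ_two, dotProduct, mulVec, cons_val_zero, cons_val_one,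
        fimFC_one_zero] at this
      linarith)
  rw [fimFC_det 0 h0 h1] at hq
  have hpos : 0 < (Fintype.card ι : ℝ) ^ 2 * (sourcePower s 0 * sourcePower s 1) := by positivity
  refine le_of_mul_le_mul_left (le_trans (le_of_eq ?_) hq) hpos
  ring

end

/-- The deterministic part of the bound: if the functions `1`, `x`, `exp (j y x)`,
`x exp (j y x)` are uniformly independent over the array and its weighted characteristic functions
are small at `y`, then so is the derivative of the average Cramér–Rao bound. -/
theorem exists_hasDerivAt_avgCrbFC_le {r : ℝ} (hr : 0 < r) :
    ∃ B ≥ 0, ∀ (ι : Type) [Fintype ι] [DecidableEq ι] [Nonempty ι] (T : ℕ) (φ : ι → ℝ)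
      (s : Fin T → Fin 2 → ℂ) (σ ω₀ y ε : ℝ), Coercive φ y r → (∀ n, |φ n| ≤ 3) →
      (∀ p ≤ 3, ‖mom φ p y‖ ≤ ε) → (∀ l, 0 < sourcePower s l) →
      ∃ d, HasDerivAt (fun x => avgCrbFC σ φ s ω₀ x) d y ∧
        |d| ≤ B * (σ ^ 2 / Fintype.card ι * (1 / sourcePower s 0 + 1 / sourcePower s 1)) * ε := by
  obtain ⟨B, hB⟩ := exists_slowAt_crbShape hr
  refine ⟨|B|, abs_nonneg B, fun ι _ _ _ T φ s σ ω₀ y ε hco hφ hmom hs => ?_⟩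
  have hε : 0 ≤ ε := (norm_nonneg _).trans (hmom 0 (by norm_num))
  obtain ⟨-, d, hd, hdb⟩ := hB (mom φ 0) (mom φ 1) (mom φ 2) (coherence s) (mom φ 1 0) (mom φ 2 0)
    y ε hε (slowAt_mom hφ (by norm_num) (hmom 1 (by norm_num)))
    (slowAt_mom hφ (by norm_num) (hmom 2 (by norm_num)))
    (slowAt_mom hφ (by norm_num) (hmom 3 (by norm_num)))
    (norm_mom_le hφ (by norm_num) 0) (norm_mom_le hφ (by norm_num) 0) (norm_coherence_le s)
    (hco.le_norm_one_sub hr) (hco.schur_det_ge hr hs)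
  have h0 := hs 0
  have h1 := hs 1
  have hN : (0 : ℝ) < Fintype.card ι := by exact_mod_cast Fintype.card_pos
  simp_rw [avgCrbFC_eq ω₀ σ h0 h1 φ]
  refine ⟨_, hd.const_mul _, ?_⟩
  rw [abs_mul, abs_of_nonneg (by positivity)]
  rw [Real.norm_eq_abs] at hdb
  calc _ ≤ σ ^ 2 / (4 * Fintype.card ι) * (1 / sourcePower s 0 + 1 / sourcePower s 1)
          * (|B| * ε) := by
        gcongr
        exact hdb.trans (mul_le_mul_of_nonneg_right (le_abs_self B) hε)
    _ = 1 / 4 * (|B| * (σ ^ 2 / Fintype.card ι *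
          (1 / sourcePower s 0 + 1 / sourcePower s 1)) * ε) := by
        field_simp
    _ ≤ _ := by
        have : 0 ≤ |B| * (σ ^ 2 / Fintype.card ι *
          (1 / sourcePower s 0 + 1 / sourcePower s 1)) * ε := by positivity
        linarith

end ArrayCRB
end

/-! ### Rescaling, concentration of the moments, and the probabilistic conclusion. -/

noncomputable section
namespace ArrayCRB
open Complex MeasureTheory ProbabilityTheory Matrix
open scoped ComplexConjugate

section Scaling
variable {ι : Type*} [Fintype ι] [DecidableEq ι] {T : ℕ} {D : ℝ}

lemma steering_div {ι : Type*} (hD : D ≠ 0) (φ : ι → ℝ) (ω₀ x : ℝ) :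
    steering φ (twoFreq ω₀ x) = steering (fun n => φ n / D) (twoFreq (ω₀ * D) (x * D)) := by
  have hD' : (D : ℂ) ≠ 0 := ofReal_ne_zero.mpr hD
  ext n l
  fin_cases l <;> simp [steering, twoFreq] <;> congr 1 <;> field_simp

lemma steeringDeriv_div {ι : Type*} (hD : D ≠ 0) (φ : ι → ℝ) (ω₀ x : ℝ) (s : Fin 2 → ℂ) :
    steeringDeriv φ (twoFreq ω₀ x) s
      = (D : ℂ) • steeringDeriv (fun n => φ n / D) (twoFreq (ω₀ * D) (x * D)) s := by
  have hD' : (D : ℂ) ≠ 0 := ofReal_ne_zero.mpr hD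
  ext n l
  have h := congrFun (congrFun (steering_div hD φ ω₀ x) n) l
  simp only [steering, of_apply] at h
  simp only [steeringDeriv, of_apply, Matrix.smul_apply, smul_eq_mul, h]
  push_cast
  field_simp

/-- The phases `ω φ` are invariant under the rescaling; only the factor `φ` in each of the two
derivative matrices contributes a `D`. -/
lemma fimFC_div (hD : D ≠ 0) (φ : ι → ℝ) (ω₀ x : ℝ) (s : Fin T → Fin 2 → ℂ) :
    fimFC φ (twoFreq ω₀ x) s
      = D ^ 2 • fimFC (fun n => φ n / D) (twoFreq (ω₀ * D) (x * D)) s := by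
  simp only [fimFC, projPerp, steeringDeriv_div hD φ, steering_div hD φ, Finset.smul_sum]
  refine Finset.sum_congr rfl fun i _ => ?_
  ext l l'
  rw [conjTranspose_smul, Matrix.smul_mul, Matrix.smul_mul, Matrix.mul_smul, smul_smul]
  simp only [map_apply, Matrix.smul_apply, smul_eq_mul, RCLike.star_def, conj_ofReal]
  rw [← ofReal_mul, re_ofReal_mul, sq]

lemma avgCrbFC_div (hD : D ≠ 0) (σ : ℝ) (φ : ι → ℝ) (ω₀ x : ℝ) (s : Fin T → Fin 2 → ℂ) :
    avgCrbFC σ φ s ω₀ x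
      = (D ^ 2)⁻¹ * avgCrbFC σ (fun n => φ n / D) s (ω₀ * D) (x * D) := by
  have hinv : ∀ M : Matrix (Fin 2) (Fin 2) ℝ, (D ^ 2 • M)⁻¹ = (D ^ 2)⁻¹ • M⁻¹ := by
    intro M
    rw [Matrix.inv_def, Matrix.inv_def, adjugate_smul, det_smul, Ring.inverse_eq_inv',
      mul_inv, smul_smul, smul_smul]
    congr 1
    simp only [Fintype.card_fin, Nat.add_one_sub_one, pow_one]
    field_simp
  rw [avgCrbFC, avgCrbFC, crbFC, crbFC, fimFC_div hD, hinv]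
  simp only [Matrix.smul_apply, smul_eq_mul]
  ring

end Scaling

lemma map_div_eq_restrict_of_isUniform {Ω : Type*} [MeasurableSpace Ω] {μ : Measure Ω} {X : Ω → ℝ}
    {D : ℝ} (hD : 0 < D)
    (hX : pdf.IsUniform X (Set.Icc 0 D) μ volume) :
    AEMeasurable X μ ∧ μ.map (fun w => X w / D) = volume.restrict (Set.Icc 0 1) := by
  have hvol : volume (Set.Icc 0 D) = ENNReal.ofReal D := by rw [Real.volume_Icc, sub_zero]
  have hpos : ENNReal.ofReal D ≠ 0 := by simpa using hD
  -- Measurability is implied by uniformity: a function that is not a.e. measurable has push-forward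
  -- zero.
  have hm : AEMeasurable X μ :=
    hX.aemeasurable (by rw [hvol]; exact hpos) (by rw [hvol]; exact ENNReal.ofReal_ne_top)
  refine ⟨hm, ?_⟩
  have hf : Measurable fun x : ℝ => D⁻¹ * x := measurable_const_mul _
  have h1 : μ.map (fun w => X w / D) = (μ.map X).map (fun x => D⁻¹ * x) := by
    rw [AEMeasurable.map_map_of_aemeasurable hf.aemeasurable hm]
    congr 1
    ext w
    simp [div_eq_inv_mul]
  have hpre : (fun x : ℝ => D⁻¹ * x) ⁻¹' Set.Icc 0 1 = Set.Icc 0 D := by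
    ext x
    simp only [Set.mem_preimage, Set.mem_Icc, inv_mul_le_iff₀ hD, mul_one]
    rw [mul_nonneg_iff_of_pos_left (inv_pos.mpr hD)]
  have h2 := Measure.restrict_map (μ := volume) hf (measurableSet_Icc (a := (0 : ℝ)) (b := 1))
  rw [hpre, Real.map_volume_mul_left (inv_ne_zero hD.ne'), inv_inv, abs_of_pos hD,
    Measure.restrict_smul] at h2
  rw [h1, hX, ProbabilityTheory.cond, Measure.map_smul, ← h2, smul_smul, hvol,
    ENNReal.inv_mul_cancel hpos ENNReal.ofReal_ne_top, one_smul]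

variable {Ω : Type*} [MeasurableSpace Ω] {μ : Measure Ω} [IsProbabilityMeasure μ] {K M : ℕ}

/-- Two-sided Hoeffding: a variable in `[-R, R]` is, after centring, sub-Gaussian with parameter `R
^ 2`. -/
lemma measureReal_abs_sum_sub_integral_ge_le {X : Fin K → Ω → ℝ} (hind : iIndepFun X μ)
    (hm : ∀ k, AEMeasurable (X k) μ) {R τ : ℝ} (hτ : 0 ≤ τ)
    (hb : ∀ k, ∀ᵐ w ∂μ, |X k w| ≤ R) :
    μ.real {w | K * τ ≤ |∑ k, (X k w - ∫ w, X k w ∂μ)|}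
      ≤ 2 * Real.exp (-(K * τ ^ 2) / (2 * R ^ 2)) := by
  have hsub : ∀ k, HasSubgaussianMGF (fun w => X k w - ∫ w, X k w ∂μ) (‖R‖₊ ^ 2) μ := by
    intro k
    have := hasSubgaussianMGF_of_mem_Icc (a := -R) (b := R) (hm k)
      ((hb k).mono fun w hw => abs_le.mp hw)
    convert this using 2
    rw [sub_neg_eq_add, ← two_mul, nnnorm_mul]
    simp
  have hind' : iIndepFun (fun k w => X k w - ∫ w, X k w ∂μ) μ :=
    hind.comp (fun k x => x - ∫ w, X k w ∂μ) fun k => measurable_id.sub_const _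
  have hexp : -(K * τ) ^ 2 / (2 * ((∑ k : Fin K, ‖R‖₊ ^ 2 : NNReal) : ℝ))
      = -(K * τ ^ 2) / (2 * R ^ 2) := by
    rcases Nat.eq_zero_or_pos K with rfl | hK
    · simp
    have hK' : (K : ℝ) ≠ 0 := by positivity
    simp only [Finset.sum_const, Finset.card_univ, Fintype.card_fin, nsmul_eq_mul, NNReal.coe_mul,
      NNReal.coe_natCast, NNReal.coe_pow, coe_nnnorm, Real.norm_eq_abs, sq_abs]
    field_simp
  have h1 := HasSubgaussianMGF.measure_sum_ge_le_of_iIndepFun hind' (s := Finset.univ)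
    (fun k _ => hsub k) (mul_nonneg (Nat.cast_nonneg K) hτ)
  have h2 := HasSubgaussianMGF.measure_sum_ge_le_of_iIndepFun
    (X := fun k w => -(X k w - ∫ w, X k w ∂μ)) (s := Finset.univ)
    (hind'.comp (fun k x => -x) fun k => measurable_neg)
    (fun k _ => (hsub k).neg) (mul_nonneg (Nat.cast_nonneg K) hτ)
  rw [hexp] at h1 h2
  calc _ ≤ μ.real ({w | K * τ ≤ ∑ k, (X k w - ∫ w, X k w ∂μ)} ∪
        {w | K * τ ≤ ∑ k, -(X k w - ∫ w, X k w ∂μ)}) := by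
        refine measureReal_mono fun w hw => ?_
        simp only [Set.mem_union, Set.mem_ofPred_eq, Finset.sum_neg_distrib] at hw ⊢
        exact le_abs.mp hw
    _ ≤ _ := (measureReal_union_le _ _).trans (by linarith)

lemma measureReal_norm_sum_sub_integral_ge_le {Z : Fin K → Ω → ℂ} (hind : iIndepFun Z μ)
    (hm : ∀ k, AEMeasurable (Z k) μ) {R τ : ℝ} (hτ : 0 ≤ τ)
    (hb : ∀ k, ∀ᵐ w ∂μ, ‖Z k w‖ ≤ R) :
    μ.real {w | 2 * (K * τ) < ‖∑ k, (Z k w - ∫ w, Z k w ∂μ)‖}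
      ≤ 4 * Real.exp (-(K * τ ^ 2) / (2 * R ^ 2)) := by
  have hint : ∀ k, Integrable (Z k) μ := fun k =>
    Integrable.of_bound (hm k).aestronglyMeasurable R (hb k)
  have h1 := measureReal_abs_sum_sub_integral_ge_le (X := fun k w => (Z k w).re)
    (hind.comp (fun _ z => z.re) fun _ => measurable_re)
    (fun k => measurable_re.comp_aemeasurable (hm k)) hτ
    fun k => (hb k).mono fun w hw => (abs_re_le_norm _).trans hw
  have h2 := measureReal_abs_sum_sub_integral_ge_le (X := fun k w => (Z k w).im)
    (hind.comp (fun _ z => z.im) fun _ => measurable_im)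
    (fun k => measurable_im.comp_aemeasurable (hm k)) hτ
    fun k => (hb k).mono fun w hw => (abs_im_le_norm _).trans hw
  calc _ ≤ μ.real ({w | K * τ ≤ |∑ k, ((Z k w).re - ∫ w, (Z k w).re ∂μ)|} ∪
        {w | K * τ ≤ |∑ k, ((Z k w).im - ∫ w, (Z k w).im ∂μ)|}) := by
        refine measureReal_mono fun w hw => ?_
        by_contra hcon
        simp only [Set.mem_union, Set.mem_ofPred_eq, not_or, not_le] at hw hcon
        have hre : (∑ k, (Z k w - ∫ w, Z k w ∂μ)).re
            = ∑ k, ((Z k w).re - ∫ w, (Z k w).re ∂μ) := by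
          rw [re_sum]
          refine Finset.sum_congr rfl fun k _ => ?_
          rw [sub_re]
          congr 1
          exact (integral_re (hint k)).symm
        have him : (∑ k, (Z k w - ∫ w, Z k w ∂μ)).im
            = ∑ k, ((Z k w).im - ∫ w, (Z k w).im ∂μ) := by
          rw [im_sum]
          refine Finset.sum_congr rfl fun k _ => ?_
          rw [sub_im]
          congr 1
          exact (integral_im (hint k)).symm
        have := norm_le_abs_re_add_abs_im (∑ k, (Z k w - ∫ w, Z k w ∂μ))
        rw [hre, him] at this
        linarith [hcon.1, hcon.2]
    _ ≤ _ := (measureReal_union_le _ _).trans (by linarith)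

/-- The mean of the weighted characteristic function of an array with displacements `δ` whose
subarrays are placed uniformly on the unit interval. -/
def expMom {ι : Type*} [Fintype ι] (δ : ι → ℝ) (p : ℕ) (y : ℝ) : ℂ :=
  (∑ n, ∫ x in (0 : ℝ)..1, chi p y (x + δ n)) / (Fintype.card ι : ℝ)

section ExpMom
variable {ι : Type*} [Fintype ι] {δ : ι → ℝ}

lemma norm_expMom_le (hδ : ∀ n, |δ n| ≤ 1) {p : ℕ} (hp : p ≤ 3) {y : ℝ} (hy : y ≠ 0) :
    ‖expMom δ p y‖ ≤ 40 / |y| := by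
  rw [expMom, norm_div, norm_real, Real.norm_of_nonneg (Nat.cast_nonneg _)]
  refine div_le_of_le_mul₀ (Nat.cast_nonneg _) (by positivity) ?_
  calc _ ≤ ∑ _n : ι, 40 / |y| := norm_sum_le_of_le _ fun n _ => norm_integral_chi_le hp hy (hδ n)
    _ = _ := by simp [mul_comm]

/-- The mean Gram form is an average of unit-interval integrals shifted by `δ n`, so it inherits
`r`; the deviation of the moments costs `4 * κ`. -/
lemma Coercive.of_expMom [Nonempty ι] {r : ℝ} {φ : ι → ℝ} {y κ : ℝ}
    (hr : ∀ δ, |δ| ≤ 1 → ∀ w : Fin 2 × Fin 2 → ℂ,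
      r * ∑ i, ‖w i‖ ^ 2 ≤ ∫ x in (0 : ℝ)..1, ‖comb w y (x + δ)‖ ^ 2)
    (hδ : ∀ n, |δ n| ≤ 1)
    (h : ∀ p ≤ 3, ∀ b b' : Fin 2, ‖mom φ p ((b : ℕ) * y - (b' : ℕ) * y)
      - expMom δ p ((b : ℕ) * y - (b' : ℕ) * y)‖ ≤ κ) :
    Coercive φ y (r - 4 * κ) := by
  intro w
  have hN : (0 : ℝ) < Fintype.card ι := by exact_mod_cast Fintype.card_pos
  have h1 := norm_gramForm_sub_le w h
  have h2 : gramForm (expMom δ) y w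
      = (((∑ n, ∫ x in (0 : ℝ)..1, ‖comb w y (x + δ n)‖ ^ 2) / (Fintype.card ι : ℝ) : ℝ) : ℂ) := by
    have := gramForm_sum Finset.univ (fun n p z => ∫ x in (0 : ℝ)..1, chi p z (x + δ n))
      (Fintype.card ι : ℝ) y w
    rw [ofReal_div, ofReal_sum]
    simp_rw [integral_norm_sq_comb]
    exact this
  have h3 : r * ∑ i, ‖w i‖ ^ 2
      ≤ (∑ n, ∫ x in (0 : ℝ)..1, ‖comb w y (x + δ n)‖ ^ 2) / (Fintype.card ι : ℝ) := by
    rw [le_div_iff₀ hN]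
    calc _ = ∑ _n : ι, r * ∑ i, ‖w i‖ ^ 2 := by simp [mul_comm]
      _ ≤ _ := Finset.sum_le_sum fun n _ => hr (δ n) (hδ n) w
  rw [gramForm_mom, h2, ← ofReal_sub, norm_real, Real.norm_eq_abs] at h1
  linarith [(abs_le.mp h1).1]

lemma norm_mom_sub_mom_le {φ φ' : ι → ℝ} {η : ℝ} (hη : 0 ≤ η) (hφ : ∀ n, |φ n| ≤ 3)
    (hφ' : ∀ n, |φ' n| ≤ 3)
    (h : ∀ n, |φ n - φ' n| ≤ η) {p : ℕ} (hp : p ≤ 3) (y : ℝ) :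
    ‖mom φ p y - mom φ' p y‖ ≤ 81 * (1 + |y|) * η := by
  rw [mom, mom, ← sub_div, norm_div, norm_real, Real.norm_of_nonneg (Nat.cast_nonneg _),
    ← Finset.sum_sub_distrib]
  refine div_le_of_le_mul₀ (Nat.cast_nonneg _) (by positivity) ?_
  calc _ ≤ ∑ _n : ι, 81 * (1 + |y|) * η := norm_sum_le_of_le _ fun n _ =>
        (norm_chi_sub_chi_le hp y (hφ n) (hφ' n)).trans (by gcongr; exact h n)
    _ = _ := by simp [mul_comm]

end ExpMom

/-- Only the subarrays are independent, so each contributes one variable, the sum over its `M`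
elements, bounded by `8 * M`. The `M` cancels against the deviation level, leaving `K` in the
exponent. -/
lemma measureReal_mom_sub_expMom_le (hK : 0 < K) (hM : 0 < M) {U : Fin K → Ω → ℝ}
    (hind : iIndepFun U μ)
    (hm : ∀ k, AEMeasurable (U k) μ)
    (hU : ∀ k, μ.map (U k) = volume.restrict (Set.Icc 0 1)) {δ : Fin K × Fin M → ℝ}
    (hδ : ∀ n, |δ n| ≤ 1) {p : ℕ} (hp : p ≤ 3) (y : ℝ) {τ : ℝ} (hτ : 0 ≤ τ) :
    μ.real {w | 2 * τ < ‖mom (fun n => U n.1 w + δ n) p y - expMom δ p y‖}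
      ≤ 4 * Real.exp (-(K * τ ^ 2) / 128) := by
  set g : Fin K → ℝ → ℂ := fun k x => ∑ m, chi p y (x + δ (k, m)) with hg
  have hgc : ∀ k, Continuous (g k) := fun k =>
    continuous_finsetSum _ fun m _ => continuous_chi_shift p y _
  have hK' : (0 : ℝ) < K := by exact_mod_cast hK
  have hM' : (0 : ℝ) < M := by exact_mod_cast hM
  have hIcc : ∀ k, ∀ᵐ w ∂μ, U k w ∈ Set.Icc (0 : ℝ) 1 := fun k =>
    ae_of_ae_map (hm k) (by rw [hU k]; exact ae_restrict_mem measurableSet_Icc)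
  have hbound : ∀ k, ∀ᵐ w ∂μ, ‖g k (U k w)‖ ≤ 8 * M := by
    intro k
    filter_upwards [hIcc k] with w hw
    calc ‖g k (U k w)‖ ≤ ∑ _m : Fin M, (8 : ℝ) := norm_sum_le_of_le _ fun m _ => by
          have := abs_le.mp (hδ (k, m))
          exact (norm_chi_le hp y (R := 2) (by norm_num)
            (abs_le.mpr ⟨by linarith [hw.1], by linarith [hw.2]⟩)).trans (by norm_num)
      _ = 8 * M := by simp [mul_comm]
  have hmean : ∀ k, ∫ w, g k (U k w) ∂μ = ∑ m, ∫ x in (0 : ℝ)..1, chi p y (x + δ (k, m)) := by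
    intro k
    rw [← integral_map (hm k) (hgc k).aestronglyMeasurable, hU k, integral_Icc_eq_integral_Ioc,
      ← intervalIntegral.integral_of_le zero_le_one]
    exact intervalIntegral.integral_finsetSum
      fun m _ => (continuous_chi_shift p y _).intervalIntegrable _ _
  have key := measureReal_norm_sum_sub_integral_ge_le (Z := fun k w => g k (U k w))
    (hind.comp g fun k => (hgc k).measurable)
    (fun k => (hgc k).measurable.comp_aemeasurable (hm k))
    (mul_nonneg hM'.le hτ) hbound
  have hexp : -(K * (M * τ) ^ 2) / (2 * (8 * (M : ℝ)) ^ 2) = -(K * τ ^ 2) / 128 := by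
    field_simp
    ring
  rw [hexp] at key
  refine le_trans (measureReal_mono fun w hw => ?_) key
  rw [Set.mem_ofPred_eq] at hw ⊢
  have hsum : ∑ k, (g k (U k w) - ∫ w, g k (U k w) ∂μ)
      = (mom (fun n => U n.1 w + δ n) p y - expMom δ p y) * ((K * M : ℝ) : ℂ) := by
    have hKM : ((K : ℂ) * M) ≠ 0 := by
      exact_mod_cast (Nat.mul_pos hK hM).ne'
    rw [mom, expMom, ← sub_div, Fintype.card_prod, Fintype.card_fin, Fintype.card_fin]
    push_cast
    rw [div_mul_cancel₀ _ hKM, Fintype.sum_prod_type, Fintype.sum_prod_type,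
      ← Finset.sum_sub_distrib]
    exact Finset.sum_congr rfl fun k _ => by rw [hmean]
  rw [hsum, norm_mul, norm_real, Real.norm_of_nonneg (by positivity)]
  calc 2 * (K * (M * τ)) = 2 * τ * (K * M) := by ring
    _ < _ := by gcongr

end ArrayCRB
end

open ArrayCRB MeasureTheory ProbabilityTheory Matrix in
theorem proposition3 :
    ∃ c > (0 : ℝ), ∃ C > (0 : ℝ),
      ∀ (Ω : Type*) [MeasurableSpace Ω] (μ : Measure Ω) [IsProbabilityMeasure μ]
        (K M T : ℕ) (D σ ω₀ Δω η t : ℝ) (s : Fin T → Fin 2 → ℂ)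
        (φ : Ω → Fin K × Fin M → ℝ) (δ : Fin K × Fin M → ℝ),
        0 < M → 0 < D → 0 < σ →
        (∀ l, ∃ i, s i l ≠ 0) →
        iIndepFun (fun (k : Fin K) (w : Ω) => subarrayMean (φ w) k) μ →
        (∀ k : Fin K, pdf.IsUniform (fun w => subarrayMean (φ w) k) (Set.Icc 0 D) μ volume) →
        (∀ n, |δ n| ≤ D) →
        0 ≤ η → η * (Δω * D) ≤ c →
        (∀ᵐ w ∂μ, ∀ n, |φ w n - subarrayMean (φ w) n.1 - δ n| ≤ η * D) →
        2 * Real.pi / D ≤ Δω →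
        0 < t → t ≤ 1 →
        μ.real {w | ¬ (((steering (φ w) (twoFreq ω₀ Δω))ᴴ *
                steering (φ w) (twoFreq ω₀ Δω)).det ≠ 0 ∧
              (fimFC (φ w) (twoFreq ω₀ Δω) s).PosDef ∧
              ∃ d : ℝ, HasDerivAt (fun x => avgCrbFC σ (φ w) s ω₀ x) d Δω ∧
                |d| ≤ C * (σ ^ 2 / ((K * M : ℕ) * D) *
                    (1 / sourcePower s 0 + 1 / sourcePower s 1)) *
                  (t + 1 / (Δω * D) + η * (Δω * D)))}
          ≤ C * Real.exp (-c * K * t ^ 2) := by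
  obtain ⟨r, hr, hcoer⟩ := exists_coercive
  obtain ⟨B, hB, hderiv⟩ := exists_hasDerivAt_avgCrbFC_le (half_pos hr)
  -- Coercivity loses `4 * (2 * τ₁ * t + 162 * η * y)`. The bounds `τ₁ ≤ r / 32` and `c ≤ r / 2592`
  -- make each summand at most `r / 4`, so `r / 2` remains.
  have hτ₁ : 0 < min (r / 32) 1 := by positivity
  set τ₁ := min (r / 32) 1
  have hτ₁r : τ₁ ≤ r / 32 := min_le_left _ _
  have hτ₁1 : τ₁ ≤ 1 := min_le_right _ _
  -- `τ₁ ^ 2 / 128` is the Hoeffding exponent, and `c ≤ 1` gives `η ≤ 1`. In `C`, `64 = 16 * 4` pays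
  -- for the union bound and `162 * B` for the derivative.
  refine ⟨min (min (r / 2592) (τ₁ ^ 2 / 128)) 1, by positivity, 64 + 162 * B, by positivity, ?_⟩
  intro Ω _ μ _ K M T D σ ω₀ Δω η t s φ δ hM hD hσ hs hind hunif hδ hη hηc hφ hΔ ht ht1
  set c := min (min (r / 2592) (τ₁ ^ 2 / 128)) 1
  have hc1 : c ≤ r / 2592 := (min_le_left _ _).trans (min_le_left _ _)
  have hc2 : c ≤ τ₁ ^ 2 / 128 := (min_le_left _ _).trans (min_le_right _ _)
  have hc3 : c ≤ 1 := min_le_right _ _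
  rcases Nat.eq_zero_or_pos K with rfl | hK
  · refine measureReal_le_one.trans ?_
    simp only [Nat.cast_zero, mul_zero, zero_mul, Real.exp_zero, mul_one]
    linarith
  have : Nonempty (Fin K × Fin M) := ⟨(⟨0, hK⟩, ⟨0, hM⟩)⟩
  set y := Δω * D with hy
  have hy2π : 2 * Real.pi ≤ y := by rwa [div_le_iff₀ hD] at hΔ
  have hy1 : 1 ≤ y := by linarith [Real.pi_gt_three]
  have hy0 : 0 < y := by linarith
  have hη1 : η ≤ 1 := by nlinarith
  have hP : ∀ l, 0 < sourcePower s l := fun l => by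
    obtain ⟨i, hi⟩ := hs l
    exact Finset.sum_pos' (fun _ _ => by positivity) ⟨i, Finset.mem_univ i, by positivity⟩
  set U : Fin K → Ω → ℝ := fun k w => subarrayMean (φ w) k / D
  have hUm : ∀ k, AEMeasurable (U k) μ := fun k =>
    (map_div_eq_restrict_of_isUniform hD (hunif k)).1.div_const D
  have hU : ∀ k, μ.map (U k) = volume.restrict (Set.Icc 0 1) := fun k =>
    (map_div_eq_restrict_of_isUniform hD (hunif k)).2
  have hUind : iIndepFun U μ := hind.comp (fun _ x => x / D) fun _ => measurable_id.div_const D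
  have hUIcc : ∀ᵐ w ∂μ, ∀ k, U k w ∈ Set.Icc (0 : ℝ) 1 := ae_all_iff.mpr fun k =>
    ae_of_ae_map (hUm k) (by rw [hU k]; exact ae_restrict_mem measurableSet_Icc)
  set δ' : Fin K × Fin M → ℝ := fun n => δ n / D with hδ'
  have hδ1 : ∀ n, |δ' n| ≤ 1 := fun n => by
    rw [hδ', abs_div, abs_of_pos hD]
    exact (div_le_one hD).mpr (hδ n)
  -- The frequencies `0` and `±y` are what coercivity needs; degree `3` at `y` is needed for the
  -- derivative of `mom φ 2`.
  set E : Fin 4 × Fin 2 × Fin 2 → Set Ω := fun j =>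
    {w | 2 * (τ₁ * t) < ‖mom (fun n => U n.1 w + δ' n) j.1 ((j.2.1 : ℕ) * y - (j.2.2 : ℕ) * y)
      - expMom δ' j.1 ((j.2.1 : ℕ) * y - (j.2.2 : ℕ) * y)‖} with hE
  have hEle : ∀ j, μ.real (E j) ≤ 4 * Real.exp (-c * K * t ^ 2) := by
    intro j
    refine (measureReal_mom_sub_expMom_le hK hM hUind hUm hU hδ1 (by omega) _
      (by positivity)).trans ?_
    gcongr
    have : c * (K * t ^ 2) ≤ τ₁ ^ 2 / 128 * (K * t ^ 2) := by gcongr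
    linarith
  have hgood : ∀ᵐ w ∂μ, w ∉ ⋃ j, E j → (((steering (φ w) (twoFreq ω₀ Δω))ᴴ *
                steering (φ w) (twoFreq ω₀ Δω)).det ≠ 0 ∧
              (fimFC (φ w) (twoFreq ω₀ Δω) s).PosDef ∧
              ∃ d : ℝ, HasDerivAt (fun x => avgCrbFC σ (φ w) s ω₀ x) d Δω ∧
                |d| ≤ (64 + 162 * B) * (σ ^ 2 / ((K * M : ℕ) * D) *
                    (1 / sourcePower s 0 + 1 / sourcePower s 1)) *
                  (t + 1 / (Δω * D) + η * (Δω * D))) := by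
    filter_upwards [hφ, hUIcc] with w hw hUw hwE
    set ψ : Fin K × Fin M → ℝ := fun n => φ w n / D with hψ
    have hψU : ∀ n, |ψ n - (U n.1 w + δ' n)| ≤ η := fun n => by
      have : ψ n - (U n.1 w + δ' n) = (φ w n - subarrayMean (φ w) n.1 - δ n) / D := by
        simp only [hψ, U, hδ']; ring
      rw [this, abs_div, abs_of_pos hD, div_le_iff₀ hD]
      exact hw n
    have hUδ : ∀ n, |U n.1 w + δ' n| ≤ 2 := fun n => by
      have h1 := hUw n.1
      have h2 := abs_le.mp (hδ1 n)
      exact abs_le.mpr ⟨by linarith [h1.1], by linarith [h1.2]⟩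
    -- One unit each from the subarray mean, the nominal displacement and the perturbation.
    have hψ3 : ∀ n, |ψ n| ≤ 3 := fun n => by
      have h1 := abs_le.mp (hψU n)
      have h2 := abs_le.mp (hUδ n)
      exact abs_le.mpr ⟨by linarith, by linarith⟩
    have hdev : ∀ p ≤ 3, ∀ b b' : Fin 2, ‖mom ψ p ((b : ℕ) * y - (b' : ℕ) * y)
        - expMom δ' p ((b : ℕ) * y - (b' : ℕ) * y)‖ ≤ 2 * (τ₁ * t) + 162 * (η * y) := by
      intro p hp b b'
      have h1 : ‖mom (fun n => U n.1 w + δ' n) p ((b : ℕ) * y - (b' : ℕ) * y)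
          - expMom δ' p ((b : ℕ) * y - (b' : ℕ) * y)‖ ≤ 2 * (τ₁ * t) := by
        by_contra hcon
        exact hwE (Set.mem_iUnion.mpr ⟨(⟨p, by omega⟩, b, b'), not_le.mp hcon⟩)
      have h2 := norm_mom_sub_mom_le hη hψ3 (fun n => (hUδ n).trans (by norm_num)) hψU hp
        ((b : ℕ) * y - (b' : ℕ) * y)
      have h3 : |(b : ℕ) * y - (b' : ℕ) * y| ≤ y := by
        fin_cases b <;> fin_cases b' <;> simp [abs_of_pos, hy0, hy0.le]
      have h4 : 81 * (1 + |(b : ℕ) * y - (b' : ℕ) * y|) * η ≤ 162 * (η * y) := by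
        calc _ ≤ 81 * (y + y) * η := by gcongr
          _ = _ := by ring
      have := norm_sub_le_norm_sub_add_norm_sub (mom ψ p ((b : ℕ) * y - (b' : ℕ) * y))
        (mom (fun n => U n.1 w + δ' n) p ((b : ℕ) * y - (b' : ℕ) * y))
        (expMom δ' p ((b : ℕ) * y - (b' : ℕ) * y))
      linarith
    have hco : Coercive ψ y (r / 2) := by
      intro v
      refine le_trans ?_ (Coercive.of_expMom (hcoer y hy2π) hδ1 hdev v)
      gcongr
      nlinarith
    have hsmall : ∀ p ≤ 3, ‖mom ψ p y‖ ≤ 162 * (t + 1 / y + η * y) := by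
      intro p hp
      have h1 := hdev p hp 1 0
      have h2 := norm_expMom_le hδ1 hp hy0.ne'
      simp only [Fin.val_one, Fin.val_zero, Nat.cast_one, Nat.cast_zero, one_mul, zero_mul,
        sub_zero] at h1
      rw [abs_of_pos hy0] at h2
      have h3 := norm_sub_norm_le (mom ψ p y) (expMom δ' p y)
      have h4 : τ₁ * t ≤ 1 * t := by gcongr
      have h5 : 40 / y = 40 * (1 / y) := by ring
      have h6 : 0 < 1 / y := by positivity
      linarith
    obtain ⟨d, hd, hdb⟩ := hderiv (Fin K × Fin M) T ψ s σ (ω₀ * D) y _ hco hψ3 hsmall hP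
    -- The bound scales by `D⁻²` and the chain rule for `y = Δω D` gives back one `D`, hence the
    -- factor `1 / D`.
    refine ⟨?_, ?_, (D ^ 2)⁻¹ * (d * D), ?_, ?_⟩
    · rw [steering_div hD.ne']
      exact hco.det_ne_zero (half_pos hr) _
    · rw [fimFC_div hD.ne']
      exact (hco.fimFC_posDef _ (half_pos hr) hP).smul (by positivity)
    · simp_rw [avgCrbFC_div hD.ne' σ (φ w)]
      refine HasDerivAt.const_mul _ ?_
      have h1 : HasDerivAt (fun x : ℝ => x * D) D Δω := by
        simpa using (hasDerivAt_id Δω).mul_const D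
      exact HasDerivAt.comp Δω hd h1
    · have hcard : (Fintype.card (Fin K × Fin M) : ℝ) = (K * M : ℕ) := by simp
      rw [hcard] at hdb
      have hKM : (0 : ℝ) < (K * M : ℕ) := by exact_mod_cast Nat.mul_pos hK hM
      have hP0 := hP 0
      have hP1 := hP 1
      have hD1 : (D ^ 2)⁻¹ * (d * D) = d / D := by field_simp
      rw [hD1, abs_div, abs_of_pos hD, div_le_iff₀ hD]
      refine hdb.trans ?_
      calc _ = 162 * B * (σ ^ 2 / ((K * M : ℕ) * D) *
                (1 / sourcePower s 0 + 1 / sourcePower s 1)) * (t + 1 / y + η * y) * D := by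
            field_simp
        _ ≤ _ := by
            gcongr
            linarith
  calc _ ≤ μ.real (⋃ j, E j) := by
        -- Monotonicity and subadditivity hold for arbitrary sets, so the failure event need not be
        -- measurable.
        refine ENNReal.toReal_mono (measure_ne_top _ _) (measure_mono_ae ?_)
        filter_upwards [hgood] with w hw hbad
        by_contra hcon
        exact hbad (hw hcon)
    _ ≤ ∑ j, μ.real (E j) := measureReal_iUnion_fintype_le _
    _ ≤ ∑ _j : Fin 4 × Fin 2 × Fin 2, 4 * Real.exp (-c * K * t ^ 2) :=
        Finset.sum_le_sum fun j _ => hEle j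
    _ = 64 * Real.exp (-c * K * t ^ 2) := by
        simp
        ring
    _ ≤ _ := by
        gcongr
        linarith
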